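/- **Setting.** Let $G$ be a simple graph on a fixed set of $n\ge 2$ ordered vertices, initially without edges, subject to edge insertions and deletions. For a positive integer $b$ let $G^b$ be the multigraph obtained from $G$ by taking every edge $b$ times. Let $\rho=\max_{\emptyset\ne S\subseteq V}|E(G[S])|/|S|$ be the maximum subgraph density of the current graph $G$. Write $\varepsilon=\eta b^{-1}$, $k=\lceil 128/\varepsilon\rceil$; $\log$ is the natural logarithm. **Algorithm.** An orientation $\overrightarrow{G}^b$ of $G^b$ is stored. For each vertex $u$ one keeps: the out-degree $d^+(u)$ in $\overrightarrow{G}^b$ (counted with multiplicity); for each neighbour $v$ the number of copies directed $u\to v$; the set $N^+(u)$ of out-neighbours in circular lists with two round-robin pointers, one for scanning and one for informing, new members being inserted immediately before the pointers; and, for each in-neighbour $w\in N^-(u)$, a *perceived out-degree* $d^+_u(w)$, where $N^-(u)$ is a linked list, sorted from high to low $j$, of non-empty buckets, $w$ lying in bucket $j$ if $(1+\varepsilon/64)^j\le d_u^+(w)<(1+\varepsilon/64)^{j+1}$ (and $j=0$ if $d_u^+(w)=0$). "$u$ informs $x$" means that $d^+_x(u)$ is set to $d^+(u)$ and $u$ is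 moved to its new bucket at $x$. When the first copy $u\to v$ is added, $d^+_v(u)$ is set to $d^+(u)$. * $\mathrm{Insert}(u\to v)$: add a copy $u\to v$. Scan the next $k$ out-neighbours $x$ of $u$ in round-robin order (all of them if there are fewer). At the first $x$ with $d^+(u)+1>(1+\varepsilon/2)\,d^+(x)$ and $d^+(u)>d^+(x)$, remove a copy $u\to x$, call $\mathrm{Insert}(x\to u)$ and return; each scanned $x$ for which this fails is informed by $u$. If no such $x$ was found, increase $d^+(u)$ by one, and $u$ informs the next $k$ vertices of $N^+(u)$ in round-robin order (all if fewer). * $\mathrm{Delete}(u\to v)$: remove a copy $u\to v$. Let $x$ be the first element of the highest bucket of $N^-(u)$. If $x$ exists, $d^+_u(x)>(1+\varepsilon/2)(d^+(u)-1)$ and $d_u^+(x)>d^+(u)$, add a copy $u\to x$ and call $\mathrm{Delete}(x\to u)$. Otherwise decrease $d^+(u)$ by one, and $u$ informs the next $k$ vertices of $N^+(u)$ in round-robin order (all if fewer). * An edge $uv$ is inserted into $G$ by $b$ successive calls of $\mathrm{Insert}(u\to v)$ if at that moment $d^+(u)\le d^+(v)$, and of $\mathrm{Insert}(v\to u)$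 otherwise. It is deleted by $b$ successive calls of $\mathrm{Delete}(u\to v)$ if at that moment some copy is directed $u\to v$, and of $\mathrm{Delete}(v\to u)$ otherwise. * Alongside, an orientation $\overrightarrow{G}$ of $G$ is maintained, in which an edge is directed the way the majority of its copies in $\overrightarrow{G}^b$ is directed (ties are broken by the order of the vertices). *Time* is the number of elementary operations: accesses to a stored number or pointer, arithmetic operations (including the computation of a bucket index) and comparisons, and every bucket passed while walking along a bucket list (from its head when an in-neighbour is new, from the old bucket when a perceived value is updated) cost $O(1)$ each. **Theorem.** For every constant $\gamma>0$ there is a constant $C$, depending only on $\gamma$, such that the following holds for all $n\ge 2$, all real $\eta>1280$ and all positive integers $b$ with $$\eta b^{-1}\le\frac{1}{100\,\log n\cdot\max\{\gamma^{-1},1\}} .$$ After every sequence of edge insertions and deletions in $G$, starting from the graph without edges: 1. $\overrightarrow{G}^b$ is an orientation of $G^b$ with $d^+(u)\le(1+\eta b^{-1})\,d^+(v)$ for every directed edge $\overrightarrow{uv}$; 2. every out-degree in $\overrightarrow{G}^b$ is at most $C\,b\,\rho$; 3. $\overrightarrow{G}$ is an orientation of $G$ in which every out-degree is at most $C\rho$;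 4. the algorithm terminates on every further insertion or deletion of an edge in $G$ and takes worst-case time at most $C\,b^3\log(2+\rho)$ for it, where $\rho$ is the maximum subgraph density at the moment of the update. In particular, if $b\le K\log n$, this is at most $C K^3\log^3 n\,\log(2+\rho)$. Moreover, for all fixed $\gamma>0$ and $\eta>1280$ there is a constant $K$ such that for every $n\ge2$ an admissible $b\le K\log n$ exists; with such a $b$ the worst-case update time is $O(\log^3 n\,\log(2+\rho))$. -/

import Mathlib

namespace DynOrient

noncomputable section

/-! ### The memory of the data structure

The vertex set is `Fin n`.  An orientation of the multigraph `G^b` (every edge of `G` taken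
`b` times) is stored through the number `mult u v` of copies directed from `u` to `v`. -/

/-- The memory.  Sets of neighbours are linked lists. `steps` counts the elementary operations
carried out so far; no operation ever reads it. -/
structure State (n : ℕ) where
  /-- the exact out-degree `d⁺(u)` in the orientation of `G^b` -/
  deg : Fin n → ℕ
  /-- `mult u v` is the number of copies of `uv` directed from `u` to `v` -/
  mult : Fin n → Fin n → ℕ
  /-- `N⁺(u)` as a circular list, starting at the pointer of the round robin that scans
  out-neighbours during insertions -/
  scanQ : Fin n → List (Fin n)
  /-- `N⁺(u)` as a circular list, starting at the pointer of the round robin that informs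
  out-neighbours of a new out-degree -/
  infoQ : Fin n → List (Fin n)
  /-- `per v u` is the perceived out-degree `d⁺_v(u)`, stored at `v` for `u ∈ N⁻(v)` -/
  per : Fin n → Fin n → ℕ
  /-- `N⁻(v)` as a list of non-empty buckets, sorted from high to low index; the entry `(j, B)`
  is the bucket `B_j` -/
  inB : Fin n → List (ℕ × List (Fin n))
  /-- the list of out-neighbours of `u` in the maintained orientation of `G` itself -/
  out : Fin n → Finset (Fin n)
  /-- number of elementary operations carried out so far -/
  steps : ℕ

/-- The memory for the graph without edges. -/
def State.empty (n : ℕ) : State n where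
  deg := fun _ => 0
  mult := fun _ _ => 0
  scanQ := fun _ => []
  infoQ := fun _ => []
  per := fun _ _ => 0
  inB := fun _ => []
  out := fun _ => ∅
  steps := 0

variable {n : ℕ}

/-- Account for `c` elementary operations. -/
def State.tick (s : State n) (c : ℕ) : State n := { s with steps := s.steps + c }

/-- Overwrite one entry of a two-dimensional table. -/
def set₂ (f : Fin n → Fin n → ℕ) (u v : Fin n) (a : ℕ) : Fin n → Fin n → ℕ :=
  Function.update f u (Function.update (f u) v a)

/-! ### Buckets

Throughout, `ε` stands for `η * b⁻¹`. -/

/-- The index `j` of the bucket for the value `d`: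
`(1 + ε / 64) ^ j ≤ d < (1 + ε / 64) ^ (j + 1)` if `1 ≤ d`, and `j = 0` if `d = 0`. -/
def level (ε : ℝ) (d : ℕ) : ℕ := ⌊Real.logb (1 + ε / 64) d⌋₊

/-- Put `w` at the front of the bucket with index `j`, creating that bucket if necessary. -/
def bucketInsert (j : ℕ) (w : Fin n) : List (ℕ × List (Fin n)) → List (ℕ × List (Fin n))
  | [] => [(j, [w])]
  | B :: L =>
    if j < B.1 then B :: bucketInsert j w L
    else if B.1 = j then (j, w :: B.2) :: L
    else (j, [w]) :: B :: L

/-- Delete `w` from the bucket with index `j`, and that bucket if it becomes empty. -/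
def bucketErase (j : ℕ) (w : Fin n) (L : List (ℕ × List (Fin n))) : List (ℕ × List (Fin n)) :=
  (L.map fun B => if B.1 = j then (B.1, B.2.erase w) else B).filter fun B => !B.2.isEmpty

/-- The number of buckets visited when one walks along the linked list between the
positions that belong to the indices `i` and `j`. -/
def walkLength (i j : ℕ) (L : List (ℕ × List (Fin n))) : ℕ :=
  (L.filter fun B => decide (min i j ≤ B.1 ∧ B.1 ≤ max i j)).length

/-- The number of buckets visited when one walks from the head of the linked list to the
position that belongs to the index `j`. -/
def headWalkLength (j : ℕ) (L : List (ℕ × List (Fin n))) : ℕ :=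
  (L.filter fun B => decide (j ≤ B.1)).length

/-! ### Elementary updates of the memory -/

/-- The edge `uv` of `G` is to be directed from `u` to `v`: more copies point from `u` to `v`
than back, ties being broken by the order of the vertices. -/
def wins (m : Fin n → Fin n → ℕ) (u v : Fin n) : Prop :=
  m v u < m u v ∨ (m u v = m v u ∧ 0 < m u v ∧ u < v)

open Classical in
/-- Refresh the direction of the edge `uv` in the orientation of `G`. -/
def reround (s : State n) (u v : Fin n) : State n :=
  let o₁ := Function.update s.out u
    (if wins s.mult u v then insert v (s.out u) else (s.out u).erase v)
  let o₂ := Function.update o₁ v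
    (if wins s.mult v u then insert u (o₁ v) else (o₁ v).erase u)
  { s with out := o₂, steps := s.steps + 2 }

/-- Add one copy of the arc `u → v`.  A new out-neighbour is put immediately before the
pointers, that is, at the end of the circular lists; `u` is put into its bucket at `v`, which
is found by walking from the head of the list of buckets.  Out-degrees are not changed. -/
def addArc (ε : ℝ) (s : State n) (u v : Fin n) : State n :=
  let s₁ := reround { s with mult := set₂ s.mult u v (s.mult u v + 1), steps := s.steps + 1 } u v
  if s.mult u v = 0 then
    { s₁ with
      scanQ := Function.update s₁.scanQ u (s₁.scanQ u ++ [v])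
      infoQ := Function.update s₁.infoQ u (s₁.infoQ u ++ [v])
      per := set₂ s₁.per v u (s₁.deg u)
      inB := Function.update s₁.inB v (bucketInsert (level ε (s₁.deg u)) u (s₁.inB v))
      steps := s₁.steps + (4 + headWalkLength (level ε (s₁.deg u)) (s₁.inB v)) }
  else s₁

/-- Remove one copy of the arc `u → v`.  Out-degrees are not changed. -/
def removeArc (ε : ℝ) (s : State n) (u v : Fin n) : State n :=
  let s₁ := reround { s with mult := set₂ s.mult u v (s.mult u v - 1), steps := s.steps + 1 } u v
  if s.mult u v = 1 then
    { s₁ with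
      scanQ := Function.update s₁.scanQ u ((s₁.scanQ u).erase v)
      infoQ := Function.update s₁.infoQ u ((s₁.infoQ u).erase v)
      inB := Function.update s₁.inB v (bucketErase (level ε (s₁.per v u)) u (s₁.inB v))
      steps := s₁.steps + 3 }
  else s₁

/-- Update `d⁺_v(u)` to `d⁺(u)` in the list of buckets of `v`, walking from the old bucket of
`u` to the new one. -/
def updatePerceived (ε : ℝ) (s : State n) (v u : Fin n) : State n :=
  let i := level ε (s.per v u)
  let j := level ε (s.deg u)
  { s with
    per := set₂ s.per v u (s.deg u)
    inB := Function.update s.inB v (bucketInsert j u (bucketErase i u (s.inB v)))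
    steps := s.steps + (3 + walkLength i j (s.inB v)) }

/-- The number `⌈128 / ε⌉` of out-neighbours treated per round. -/
def batch (ε : ℝ) : ℕ := ⌈128 / ε⌉₊

/-- The next `⌈128 / ε⌉` out-neighbours of `u` (all of them, if there are fewer) are informed
of the out-degree of `u`, and the pointer is moved behind them. -/
def inform (ε : ℝ) (s : State n) (u : Fin n) : State n :=
  let c := min (batch ε) (s.infoQ u).length
  let s₁ := ((s.infoQ u).take c).foldl (fun t w => (updatePerceived ε t w u).tick 1) s
  { s₁ with infoQ := Function.update s₁.infoQ u ((s.infoQ u).rotate c) }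

/-- Set `d⁺(u)` to `d` and inform the next out-neighbours of `u` in round-robin fashion. -/
def setDegree (ε : ℝ) (s : State n) (u : Fin n) (d : ℕ) : State n :=
  inform ε { s with deg := Function.update s.deg u d, steps := s.steps + 1 } u

/-! ### Insertion and deletion of a single arc -/

/-- Increasing `d⁺(u)` by one would make the arc `u → x` too steep. The second condition only
matters for out-degrees below `2 / ε`. -/
def scanFlips (ε : ℝ) (s : State n) (u x : Fin n) : Prop :=
  (1 + ε / 2) * (s.deg x : ℝ) < (s.deg u : ℝ) + 1 ∧ s.deg x < s.deg u

open Classical in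
/-- Scan the next `c` out-neighbours of `u`, one after the other. Stop at the first one, `x`,
for which the arc `u → x` has to be flipped, and return it; inform the others of `d⁺(u)`. -/
def scan (ε : ℝ) (u : Fin n) : ℕ → State n → State n × Option (Fin n)
  | 0, s => (s, none)
  | c + 1, s =>
    match s.scanQ u with
    | [] => (s, none)
    | x :: L =>
      if scanFlips ε s u x then (s.tick 1, some x)
      else
        let s₁ := (updatePerceived ε s x u).tick 1
        scan ε u c { s₁ with scanQ := Function.update s₁.scanQ u (L ++ [x]) }

/-- Insertion of a copy directed from `u` to `v` into `G^b`, with the recursion cut off (value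
`none`) at depth `fuel`. -/
def insertRec (ε : ℝ) : ℕ → State n → Fin n → Fin n → Option (State n)
  | 0, _, _, _ => none
  | fuel + 1, s, u, v =>
    let s₁ := addArc ε s u v
    match scan ε u (min (batch ε) (s₁.scanQ u).length) s₁ with
    | (s₂, some x) => insertRec ε fuel (removeArc ε s₂ u x) x u
    | (s₂, none) => some (setDegree ε s₂ u (s₂.deg u + 1))

/-- The first element of the first (hence highest) bucket of `u`. -/
def firstIn (s : State n) (u : Fin n) : Option (Fin n) :=
  s.inB u |>.head?.bind fun B => B.2.head?

/-- Decreasing `d⁺(u)` by one would make the arc `x → u` too steep, judged by the perceived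
out-degree of `x`. The second condition only matters for out-degrees below `2 / ε + 1`. -/
def deletionFlips (ε : ℝ) (s : State n) (u x : Fin n) : Prop :=
  (1 + ε / 2) * ((s.deg u : ℝ) - 1) < (s.per u x : ℝ) ∧ s.deg u < s.per u x

open Classical in
/-- Deletion of a copy directed from `u` to `v` from `G^b`, with the recursion cut off (value
`none`) at depth `fuel`. -/
def deleteRec (ε : ℝ) : ℕ → State n → Fin n → Fin n → Option (State n)
  | 0, _, _, _ => none
  | fuel + 1, s, u, v =>
    let s₁ := (removeArc ε s u v).tick 1
    match firstIn s₁ u with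
    | some x =>
      if deletionFlips ε s₁ u x then deleteRec ε fuel (addArc ε s₁ u x) x u
      else some (setDegree ε s₁ u (s₁.deg u - 1))
    | none => some (setDegree ε s₁ u (s₁.deg u - 1))

open Classical in
/-- The value of a recursive procedure without any bound on the depth of the recursion, given
its versions cut off at each depth; the value is `none` if the procedure never returns. -/
def unbounded (f : ℕ → Option (State n)) : Option (State n) :=
  if h : ∃ fuel, (f fuel).isSome then f (Nat.find h) else none

/-- Insertion of a copy directed from `u` to `v` into `G^b`. -/
def insertArc (ε : ℝ) (s : State n) (u v : Fin n) : Option (State n) :=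
  unbounded fun fuel => insertRec ε fuel s u v

/-- Deletion of a copy directed from `u` to `v` from `G^b`. -/
def deleteArc (ε : ℝ) (s : State n) (u v : Fin n) : Option (State n) :=
  unbounded fun fuel => deleteRec ε fuel s u v

/-! ### Updates of the graph `G` -/

/-- Run `f` successively `c` times. -/
def repeatRun (f : State n → Option (State n)) : ℕ → State n → Option (State n)
  | 0, s => some s
  | c + 1, s => (f s).bind (repeatRun f c)

/-- Insertion of the edge `uv` into `G`: `b` copies are inserted one by one into `G^b`, each
directed away from the endpoint whose out-degree is smaller at that moment. -/
def insertEdge (η : ℝ) (b : ℕ) (s : State n) (u v : Fin n) : Option (State n) :=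
  repeatRun (fun t =>
    if t.deg u ≤ t.deg v then insertArc (η / b) (t.tick 1) u v
    else insertArc (η / b) (t.tick 1) v u) b s

/-- Deletion of the edge `uv` from `G`: its `b` copies are deleted one by one from `G^b`. -/
def deleteEdge (η : ℝ) (b : ℕ) (s : State n) (u v : Fin n) : Option (State n) :=
  repeatRun (fun t =>
    if 0 < t.mult u v then deleteArc (η / b) (t.tick 1) u v
    else deleteArc (η / b) (t.tick 1) v u) b s

/-- `Reachable η b G s`: after some sequence of edge insertions and deletions, starting from
the graph without edges, the current graph is `G` and the memory is `s`. -/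
inductive Reachable (η : ℝ) (b : ℕ) : SimpleGraph (Fin n) → State n → Prop
  | empty : Reachable η b ⊥ (State.empty n)
  | insert {G : SimpleGraph (Fin n)} {s s' : State n} {u v : Fin n} :
      Reachable η b G s → u ≠ v → ¬ G.Adj u v → insertEdge η b s u v = some s' →
      Reachable η b (G ⊔ SimpleGraph.edge u v) s'
  | delete {G : SimpleGraph (Fin n)} {s s' : State n} {u v : Fin n} :
      Reachable η b G s → G.Adj u v → deleteEdge η b s u v = some s' →
      Reachable η b (G.deleteEdges {s(u, v)}) s'

/-! ### The notions in the statement -/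

/-- The maximum subgraph density: the maximum of `|E(G[S])| / |S|` over the non-empty vertex
sets `S` (the empty set contributes `0 / 0 = 0`). -/
def maxDensity (G : SimpleGraph (Fin n)) : ℝ :=
  ⨆ S : Finset (Fin n), ((G.induce (S : Set (Fin n))).edgeSet.ncard : ℝ) / (S.card : ℝ)

open Classical in
/-- `m` describes an orientation of the multigraph `G^b`. -/
def IsOrientationOfCopies (b : ℕ) (G : SimpleGraph (Fin n)) (m : Fin n → Fin n → ℕ) : Prop :=
  ∀ u v, m u v + m v u = if G.Adj u v then b else 0

/-- Out-degree, with multiplicities, in an orientation of `G^b`. -/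
def outDegree (m : Fin n → Fin n → ℕ) (u : Fin n) : ℕ := ∑ v, m u v

/-- The sets `A u` are the out-neighbourhoods of an orientation of `G`. -/
def IsOrientation (G : SimpleGraph (Fin n)) (A : Fin n → Finset (Fin n)) : Prop :=
  ∀ u v, ((v ∈ A u ∨ u ∈ A v) ↔ G.Adj u v) ∧ ¬ (v ∈ A u ∧ u ∈ A v)

/-- The admissible parameters. -/
def Admissible (γ η : ℝ) (n b : ℕ) : Prop :=
  2 ≤ n ∧ 0 < b ∧ 1280 < η ∧ η * (b : ℝ)⁻¹ ≤ 1 / (100 * Real.log n * max γ⁻¹ 1)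

/-- The run that leads from the memory `s` to `r` terminates, within time
`C * b ^ 3 * log (2 + ρ)`, and therefore within time `C * K ^ 3 * (log n) ^ 3 * log (2 + ρ)`
whenever `b ≤ K * log n`. -/
def TerminatesWithin (C ρ : ℝ) (b : ℕ) (s : State n) (r : Option (State n)) : Prop :=
  ∃ s', r = some s' ∧
    ((s'.steps : ℝ) - s.steps ≤ C * (b : ℝ) ^ 3 * Real.log (2 + ρ)) ∧
    ∀ K : ℝ, (b : ℝ) ≤ K * Real.log n →
      (s'.steps : ℝ) - s.steps ≤ C * K ^ 3 * (Real.log n) ^ 3 * Real.log (2 + ρ)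

end

end DynOrient

namespace DynOrient

open Finset

variable {n : ℕ}

/-! ### Lists -/

/-! The round robins guarantee that stored information is out of date by only a small relative
amount. Write k for `batch ε`. For an arc u → w let t count the changes of the out-degree d of u
since w was last informed, and let i be the position of w behind the informing pointer. Then i + (k
- 1) t ≤ d persists. It holds with t = 0 when w is new or just informed, because positions are
bounded by the number of out-neighbours. A change of d that misses w lowers i by k and raises t by
one, so the left side drops by one while d drops by at most one. Since ε (k - 1) ≥ 127, it follows
that t ≤ ε d / 127. This is `InfoOK`; `SlopeOK` applies the same count to the scanning pointer and
the increments of d.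

The slack in the slope is spent in stages. Flips are decided at 1 + ε/2. A failed test, even on
perceived degrees sorted into buckets of ratio 1 + ε/64, gives 1 + 3ε/4 (`slopeBound`,
`Inv.deg_le_of_not_deletionFlips`). Increments since the last scan raise this to 1 + ε
(`Inv.arc_le`). For small degrees each bound has the alternative d + 1. The final orientation
absorbs it, because the two ends of an edge have total out-degree at least b
(`Inv.arc_le_of_orientation`).

Along a chain of flips the out-degrees move monotonically: by at least one always, and by a factor 1
+ ε/4 above k. So the recursion has depth at most about k + ε⁻¹ log(d/k) (`depth`), each level costs
O(k), and an edge has b copies (`insertRec_spec`, `deleteRec_spec`, `arcTime_le`).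

The degree bound is an expansion argument (`outDegree_le_of_slope`). If some out-degree D exceeded
4bρ, the sets of vertices of out-degree at least D / (1 + ε)^i would double in size with each i.
After log₂ n + 1 rounds they would have more than n elements, while the thresholds would still be at
least D/2. -/

theorem idxOf_erase_le {α : Type*} [DecidableEq α] (l : List α) {a b : α} (h : a ≠ b) :
    (l.erase b).idxOf a ≤ l.idxOf a := by
  induction l with
  | nil => simp
  | cons c l ih =>
    by_cases hcb : c = b
    · subst hcb
      rw [List.erase_cons_head, List.idxOf_cons_ne _ h.symm]
      omega
    · rw [List.erase_cons_tail (by simpa using hcb)]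
      by_cases hca : c = a
      · subst hca; simp
      · rw [List.idxOf_cons_ne _ hca, List.idxOf_cons_ne _ hca]
        omega

/-! ### Levels -/

theorem level_zero (ε : ℝ) : level ε 0 = 0 := by simp [level]

theorem level_mono {ε : ℝ} (hε : 0 < ε) {p q : ℕ} (h : p ≤ q) : level ε p ≤ level ε q := by
  rcases Nat.eq_zero_or_pos p with rfl | hp
  · simp [level_zero]
  · exact Nat.floor_le_floor (Real.logb_le_logb_of_le (by linarith) (by exact_mod_cast hp)
      (by exact_mod_cast h))

theorem level_le_add {ε : ℝ} (hε : 0 < ε) {p q m : ℕ} (hp : 0 < p)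
    (h : (q : ℝ) ≤ (1 + ε / 64) ^ m * p) : level ε q ≤ level ε p + m := by
  rcases Nat.eq_zero_or_pos q with rfl | hq
  · simp [level_zero]
  have hb : 1 < 1 + ε / 64 := by linarith
  have hp' : (0 : ℝ) < p := by exact_mod_cast hp
  have hq' : (0 : ℝ) < q := by exact_mod_cast hq
  have h1 : Real.logb (1 + ε / 64) q ≤ Real.logb (1 + ε / 64) p + m := by
    have := Real.logb_le_logb_of_le hb hq' h
    rw [Real.logb_mul (by positivity) (by positivity), Real.logb_pow,
      Real.logb_self_eq_one hb] at this
    linarith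
  have h0 : 0 ≤ Real.logb (1 + ε / 64) p := Real.logb_nonneg hb (by exact_mod_cast hp)
  calc level ε q ≤ ⌊Real.logb (1 + ε / 64) p + m⌋₊ := Nat.floor_le_floor h1
    _ = level ε p + m := Nat.floor_add_natCast h0 m

/-- A bucket spans a factor 1 + ε/64. Positivity of p matters, since 0 and 1 share bucket 0. -/
theorem lt_of_level_le {ε : ℝ} (hε : 0 < ε) {p q : ℕ} (hp : 0 < p)
    (h : level ε q ≤ level ε p) : (q : ℝ) < (1 + ε / 64) * p := by
  have hb : 1 < 1 + ε / 64 := by linarith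
  have hp' : (0 : ℝ) < p := by exact_mod_cast hp
  rcases Nat.eq_zero_or_pos q with rfl | hq
  · push_cast; positivity
  have hq' : (0 : ℝ) < q := by exact_mod_cast hq
  have h0 : 0 ≤ Real.logb (1 + ε / 64) p := Real.logb_nonneg hb (by exact_mod_cast hp)
  have h1 : Real.logb (1 + ε / 64) q < level ε q + 1 := Nat.lt_floor_add_one _
  have h2 : (level ε p : ℝ) ≤ Real.logb (1 + ε / 64) p := Nat.floor_le h0
  have h3 : (level ε q : ℝ) ≤ level ε p := by exact_mod_cast h
  have h4 : Real.logb (1 + ε / 64) q < Real.logb (1 + ε / 64) ((1 + ε / 64) * p) := by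
    rw [Real.logb_mul (by positivity) (by positivity), Real.logb_self_eq_one hb]
    linarith
  exact (Real.logb_lt_logb_iff hb hq' (by positivity)).1 h4

/-! ### Bucket lists -/

/-- `L` is a list of buckets for the set `S`, in which `w` lies in the bucket `key w`. -/
structure IsBuckets (L : List (ℕ × List (Fin n))) (S : Fin n → Prop) (key : Fin n → ℕ) :
    Prop where
  sorted : L.Pairwise fun B C => C.1 < B.1
  nonempty : ∀ B ∈ L, B.2 ≠ []
  nodup : ∀ B ∈ L, B.2.Nodup
  mem : ∀ j w, (∃ B ∈ L, B.1 = j ∧ w ∈ B.2) ↔ S w ∧ key w = j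

theorem IsBuckets.congr {L : List (ℕ × List (Fin n))} {S S' : Fin n → Prop}
    {key key' : Fin n → ℕ} (h : IsBuckets L S key) (hS : ∀ w, S' w ↔ S w)
    (hkey : ∀ w, S w → key' w = key w) : IsBuckets L S' key' := by
  refine ⟨h.sorted, h.nonempty, h.nodup, fun j w => ?_⟩
  rw [h.mem, hS]
  constructor
  · rintro ⟨a, b⟩; exact ⟨a, by rw [hkey w a, b]⟩
  · rintro ⟨a, b⟩; exact ⟨a, by rw [← hkey w a, b]⟩

theorem mem_bucketInsert (j : ℕ) (w : Fin n) (L : List (ℕ × List (Fin n))) (i : ℕ) (x : Fin n) :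
    (∃ B ∈ bucketInsert j w L, B.1 = i ∧ x ∈ B.2) ↔
      (∃ B ∈ L, B.1 = i ∧ x ∈ B.2) ∨ (j = i ∧ x = w) := by
  induction L with
  | nil => simp [bucketInsert]
  | cons B L ih =>
    unfold bucketInsert
    split_ifs with h1 h2
    · simp only [List.exists_mem_cons_iff, ih, or_assoc]
    · subst h2
      rw [List.exists_mem_cons_iff, List.exists_mem_cons_iff]
      generalize (∃ C ∈ L, C.1 = i ∧ x ∈ C.2) = Q
      simp only [List.mem_cons]
      tauto
    · simp only [List.exists_mem_cons_iff, List.mem_singleton]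
      rw [or_comm]

theorem fst_mem_bucketInsert {j : ℕ} {w : Fin n} {L : List (ℕ × List (Fin n))}
    {C : ℕ × List (Fin n)} (h : C ∈ bucketInsert j w L) : C.1 = j ∨ ∃ B ∈ L, B.1 = C.1 := by
  induction L with
  | nil => simp only [bucketInsert, List.mem_singleton] at h; simp [h]
  | cons B L ih =>
    unfold bucketInsert at h
    split_ifs at h with h1 h2
    · rcases List.mem_cons.1 h with rfl | h
      · right; exact ⟨C, by simp, rfl⟩
      · rcases ih h with h | ⟨D, hD, e⟩
        · exact Or.inl h
        · exact Or.inr ⟨D, by simp [hD], e⟩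
    · rcases List.mem_cons.1 h with rfl | h
      · left; rfl
      · exact Or.inr ⟨C, by simp [h], rfl⟩
    · rcases List.mem_cons.1 h with rfl | h
      · left; rfl
      · exact Or.inr ⟨C, h, rfl⟩

theorem sorted_bucketInsert (j : ℕ) (w : Fin n) {L : List (ℕ × List (Fin n))}
    (h : L.Pairwise fun B C => C.1 < B.1) :
    (bucketInsert j w L).Pairwise fun B C => C.1 < B.1 := by
  induction L with
  | nil => simp [bucketInsert]
  | cons B L ih =>
    rw [List.pairwise_cons] at h
    unfold bucketInsert
    split_ifs with h1 h2
    · refine List.pairwise_cons.2 ⟨fun C hC => ?_, ih h.2⟩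
      rcases fst_mem_bucketInsert hC with e | ⟨D, hD, e⟩
      · omega
      · have := h.1 D hD; omega
    · exact List.pairwise_cons.2 ⟨fun C hC => h2 ▸ h.1 C hC, h.2⟩
    · refine List.pairwise_cons.2 ⟨fun C hC => ?_, List.pairwise_cons.2 h⟩
      rcases List.mem_cons.1 hC with rfl | hC
      · show C.1 < j; omega
      · have := h.1 C hC
        show C.1 < j; omega

theorem ne_nil_of_mem_bucketInsert {j : ℕ} {w : Fin n} {L : List (ℕ × List (Fin n))}
    (h : ∀ B ∈ L, B.2 ≠ []) : ∀ B ∈ bucketInsert j w L, B.2 ≠ [] := by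
  induction L with
  | nil => simp [bucketInsert]
  | cons B L ih =>
    rw [List.forall_mem_cons] at h
    unfold bucketInsert
    split_ifs with h1 h2 <;> simp only [List.forall_mem_cons]
    · exact ⟨h.1, ih h.2⟩
    · exact ⟨by simp, h.2⟩
    · exact ⟨by simp, h⟩

theorem nodup_of_mem_bucketInsert {j : ℕ} {w : Fin n} {L : List (ℕ × List (Fin n))}
    (h : ∀ B ∈ L, B.2.Nodup) (hw : ∀ B ∈ L, w ∉ B.2) :
    ∀ B ∈ bucketInsert j w L, B.2.Nodup := by
  induction L with
  | nil => simp [bucketInsert]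
  | cons B L ih =>
    rw [List.forall_mem_cons] at h hw
    unfold bucketInsert
    split_ifs with h1 h2 <;> simp only [List.forall_mem_cons]
    · exact ⟨h.1, ih h.2 hw.2⟩
    · exact ⟨List.nodup_cons.2 ⟨hw.1, h.1⟩, h.2⟩
    · exact ⟨by simp, h⟩

theorem IsBuckets.insert {L : List (ℕ × List (Fin n))} {S : Fin n → Prop} {key : Fin n → ℕ}
    (h : IsBuckets L S key) {w : Fin n} (hw : ¬ S w) (j : ℕ) :
    IsBuckets (bucketInsert j w L) (fun x => S x ∨ x = w) (Function.update key w j) := by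
  refine ⟨sorted_bucketInsert j w h.sorted, ne_nil_of_mem_bucketInsert h.nonempty,
    nodup_of_mem_bucketInsert h.nodup fun B hB hwB => hw ((h.mem _ _).1 ⟨B, hB, rfl, hwB⟩).1,
    fun i x => ?_⟩
  rw [mem_bucketInsert, h.mem]
  by_cases hx : x = w
  · subst hx; simp [hw]
  · simp [hx]

theorem IsBuckets.erase {L : List (ℕ × List (Fin n))} {S : Fin n → Prop} {key : Fin n → ℕ}
    (h : IsBuckets L S key) (w : Fin n) :
    IsBuckets (bucketErase (key w) w L) (fun x => S x ∧ x ≠ w) key := by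
  unfold bucketErase
  refine ⟨?_, ?_, ?_, ?_⟩
  · refine List.Pairwise.filter _ ?_
    rw [List.pairwise_map]
    refine h.sorted.imp fun {B C} hBC => ?_
    split_ifs <;> exact hBC
  · intro B hB
    simpa using (List.mem_filter.1 hB).2
  · intro B hB
    obtain ⟨C, hC, rfl⟩ := List.mem_map.1 (List.mem_filter.1 hB).1
    split_ifs
    · exact (h.nodup C hC).erase w
    · exact h.nodup C hC
  · intro j x
    rw [show ((S x ∧ x ≠ w) ∧ key x = j) ↔ ((S x ∧ key x = j) ∧ x ≠ w) by tauto, ← h.mem]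
    constructor
    · rintro ⟨B, hB, rfl, hx⟩
      obtain ⟨C, hC, rfl⟩ := List.mem_map.1 (List.mem_filter.1 hB).1
      split_ifs at hx ⊢ with hj
      · have := (h.nodup C hC).mem_erase_iff.1 hx
        exact ⟨⟨C, hC, rfl, this.2⟩, this.1⟩
      · refine ⟨⟨C, hC, rfl, hx⟩, ?_⟩
        rintro rfl
        exact hj ((h.mem _ _).1 ⟨C, hC, rfl, hx⟩).2.symm
    · rintro ⟨⟨C, hC, rfl, hx⟩, hxw⟩
      by_cases hj : C.1 = key w
      · have hx' : x ∈ C.2.erase w := (h.nodup C hC).mem_erase_iff.2 ⟨hxw, hx⟩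
        refine ⟨(C.1, C.2.erase w), List.mem_filter.2 ⟨List.mem_map.2 ⟨C, hC, if_pos hj⟩, ?_⟩,
          rfl, hx'⟩
        simpa using List.ne_nil_of_mem hx'
      · refine ⟨C, List.mem_filter.2 ⟨List.mem_map.2 ⟨C, hC, if_neg hj⟩, ?_⟩, rfl, hx⟩
        simpa using List.ne_nil_of_mem hx

theorem IsBuckets.exists_key {L : List (ℕ × List (Fin n))} {S : Fin n → Prop} {key : Fin n → ℕ}
    (h : IsBuckets L S key) {B : ℕ × List (Fin n)} (hB : B ∈ L) : ∃ w, S w ∧ key w = B.1 := by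
  obtain ⟨w, hw⟩ := List.exists_mem_of_ne_nil _ (h.nonempty B hB)
  exact ⟨w, (h.mem _ _).1 ⟨B, hB, rfl, hw⟩⟩

/-- Strict sorting makes the indices distinct, so buckets can be counted by their indices. -/
theorem IsBuckets.length_filter_le {L : List (ℕ × List (Fin n))} {S : Fin n → Prop}
    {key : Fin n → ℕ} (h : IsBuckets L S key) (P : ℕ × List (Fin n) → Bool) (F : Finset ℕ)
    (hF : ∀ B ∈ L, P B → B.1 ∈ F) : (L.filter P).length ≤ F.card := by
  have hnd : ((L.filter P).map Prod.fst).Nodup := by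
    rw [List.Nodup, List.pairwise_map]
    exact (h.sorted.filter P).imp fun {B C} hBC => (ne_of_lt hBC).symm
  rw [← List.length_map (f := Prod.fst), ← List.toFinset_card_of_nodup hnd]
  refine Finset.card_le_card fun j hj => ?_
  obtain ⟨B, hB, rfl⟩ := List.mem_map.1 (List.mem_toFinset.1 hj)
  exact hF B (List.mem_filter.1 hB).1 (List.mem_filter.1 hB).2

theorem IsBuckets.length_filter_le_of_level {ε : ℝ} (hε : 0 < ε) {L : List (ℕ × List (Fin n))}
    {S : Fin n → Prop} {per : Fin n → ℕ} (h : IsBuckets L S fun w => level ε (per w))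
    (P : ℕ × List (Fin n) → Bool) {p q : ℕ} (hpq : p ≤ q)
    (hP : ∀ B ∈ L, P B → level ε p ≤ B.1 ∧ B.1 ≤ level ε q) :
    (L.filter P).length ≤ q - p + 1 ∧ (L.filter P).length ≤ level ε q - level ε p + 1 := by
  constructor
  · refine (h.length_filter_le P ((Finset.Icc p q).image (level ε)) fun B hB hPB => ?_).trans
      (Finset.card_image_le.trans (by rw [Nat.card_Icc]; omega))
    obtain ⟨w, -, hw⟩ := h.exists_key hB
    obtain ⟨h1, h2⟩ := hP B hB hPB
    rw [← hw] at h1 h2 ⊢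
    rw [Finset.mem_image]
    -- A value outside [p, q] may share the level of an endpoint. That endpoint then represents its
    -- bucket.
    rcases lt_or_ge (per w) p with hp | hp
    · exact ⟨p, Finset.mem_Icc.2 ⟨le_rfl, hpq⟩, le_antisymm h1 (level_mono hε hp.le)⟩
    rcases lt_or_ge q (per w) with hq | hq
    · exact ⟨q, Finset.mem_Icc.2 ⟨hpq, le_rfl⟩, le_antisymm (level_mono hε hq.le) h2⟩
    · exact ⟨per w, Finset.mem_Icc.2 ⟨hp, hq⟩, rfl⟩
  · refine (h.length_filter_le P (Finset.Icc (level ε p) (level ε q)) fun B hB hPB =>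
      Finset.mem_Icc.2 (hP B hB hPB)).trans (by rw [Nat.card_Icc]; omega)

/-- Few values, or few levels, lie between `p` and `q`. -/
def Close (ε : ℝ) (c p q : ℕ) : Prop :=
  (p ≤ q + c ∧ q ≤ p + c) ∨ (level ε p ≤ level ε q + c ∧ level ε q ≤ level ε p + c)

theorem IsBuckets.walkLength_le {ε : ℝ} (hε : 0 < ε) {L : List (ℕ × List (Fin n))}
    {S : Fin n → Prop} {per : Fin n → ℕ} (h : IsBuckets L S fun w => level ε (per w)) {c p q : ℕ}
    (hc : Close ε c p q) : walkLength (level ε p) (level ε q) L ≤ c + 1 := by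
  unfold walkLength
  rcases le_total p q with hpq | hpq
  · have hl := level_mono hε hpq
    obtain ⟨h1, h2⟩ := h.length_filter_le_of_level hε (fun B => decide (min (level ε p) (level ε q)
      ≤ B.1 ∧ B.1 ≤ max (level ε p) (level ε q))) hpq fun B _ hB => by simpa [hl] using hB
    rcases hc with hc | hc <;> omega
  · have hl := level_mono hε hpq
    obtain ⟨h1, h2⟩ := h.length_filter_le_of_level hε (fun B => decide (min (level ε p) (level ε q)
      ≤ B.1 ∧ B.1 ≤ max (level ε p) (level ε q))) hpq fun B _ hB => by simpa [hl] using hB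
    rcases hc with hc | hc <;> omega

theorem IsBuckets.headWalkLength_le {ε : ℝ} (hε : 0 < ε) {L : List (ℕ × List (Fin n))}
    {S : Fin n → Prop} {per : Fin n → ℕ} (h : IsBuckets L S fun w => level ε (per w)) {p q : ℕ}
    (hpq : p ≤ q) (hq : ∀ w, S w → per w ≤ q) :
    headWalkLength (level ε p) L ≤ q - p + 1 ∧
      headWalkLength (level ε p) L ≤ level ε q - level ε p + 1 := by
  refine h.length_filter_le_of_level hε _ hpq fun B hB hPB => ⟨by simpa using hPB, ?_⟩
  obtain ⟨w, hw, e⟩ := h.exists_key hB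
  exact e ▸ level_mono hε (hq w hw)


/-! ### Parameters -/

/-- The range of the parameter `ε`. -/
def Small (ε : ℝ) : Prop := 0 < ε ∧ ε ≤ 1 / 69

/-- Here κ is the multiplier k - 1 of the invariants. The lower bound turns κ t ≤ d into t ≤ ε d /
127; the upper bound serves only the running time. -/
theorem Small.batch {ε : ℝ} (h : Small ε) :
    ∃ κ : ℕ, batch ε = κ + 1 ∧ 127 ≤ ε * κ ∧ ε * κ ≤ 128 := by
  obtain ⟨h0, h1⟩ := h
  have hk : 128 / ε ≤ (DynOrient.batch ε : ℝ) := Nat.le_ceil _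
  have hk' : (DynOrient.batch ε : ℝ) < 128 / ε + 1 := Nat.ceil_lt_add_one (by positivity)
  have hpos : (0 : ℝ) < DynOrient.batch ε := lt_of_lt_of_le (by positivity) hk
  obtain ⟨κ, hκ⟩ := Nat.exists_eq_succ_of_ne_zero (Nat.pos_iff_ne_zero.1 (by exact_mod_cast hpos))
  refine ⟨κ, hκ, ?_, ?_⟩
  · rw [hκ] at hk
    push_cast at hk
    rw [div_le_iff₀ h0] at hk
    linarith
  · rw [hκ] at hk'
    push_cast at hk'
    have : (κ : ℝ) ≤ 128 / ε := by linarith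
    rw [le_div_iff₀ h0] at this
    linarith

/-- The bound for the out-degree of an in-neighbour of a vertex of out-degree `d`, up to the
increments since the last scan. -/
noncomputable def slopeBound (ε : ℝ) (d : ℕ) : ℝ := max ((1 + 3 * ε / 4) * d) (d + 1)

theorem slopeBound_mono {ε : ℝ} (h : 0 < ε) {d e : ℕ} (hde : d ≤ e) :
    slopeBound ε d ≤ slopeBound ε e := by
  have : (d : ℝ) ≤ e := by exact_mod_cast hde
  exact max_le_max (by gcongr) (by linarith)

/-! ### The invariant -/

theorem set₂_apply (f : Fin n → Fin n → ℕ) (u v : Fin n) (a : ℕ) (x y : Fin n) :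
    set₂ f u v a x y = if x = u ∧ y = v then a else f x y := by
  unfold set₂
  by_cases hx : x = u
  · subst hx
    by_cases hy : y = v
    · subst hy; simp
    · simp [hy]
  · simp [hx]

/-- The data structures describe the arcs and the perceived out-degrees. -/
structure Core (ε : ℝ) (s : State n) : Prop where
  loopless : ∀ u, s.mult u u = 0
  out_iff : ∀ u v, v ∈ s.out u ↔ wins s.mult u v
  scan_nodup : ∀ u, (s.scanQ u).Nodup
  scan_mem : ∀ u v, v ∈ s.scanQ u ↔ 0 < s.mult u v
  info_nodup : ∀ u, (s.infoQ u).Nodup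
  info_mem : ∀ u v, v ∈ s.infoQ u ↔ 0 < s.mult u v
  buckets : ∀ v, IsBuckets (s.inB v) (fun w => 0 < s.mult w v) fun w => level ε (s.per v w)

/-- Perceived out-degrees are accurate: `t` bounds the number of changes of `d⁺(u)` since `w`
was last informed. -/
def InfoOK (ε : ℝ) (s : State n) : Prop :=
  ∀ u w, 0 < s.mult u w → ∃ t, s.deg u ≤ s.per w u + t ∧ s.per w u ≤ s.deg u + t ∧
    (s.infoQ u).idxOf w + (batch ε - 1) * t ≤ s.deg u

/-- No arc is too steep: `t` bounds the number of increments of `d⁺(u)` since `x` was last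
scanned. -/
def SlopeOK (ε : ℝ) (deg : Fin n → ℕ) (mult : Fin n → Fin n → ℕ)
    (scanQ : Fin n → List (Fin n)) : Prop :=
  ∀ u x, 0 < mult u x → ∃ t : ℕ, (deg u : ℝ) ≤ slopeBound ε (deg x) + t ∧
    (scanQ u).idxOf x + (batch ε - 1) * t ≤ deg u

/-- The invariant that holds whenever no out-degree is being changed. -/
structure Inv (ε : ℝ) (s : State n) : Prop extends Core ε s where
  sum_le : ∀ u, outDegree s.mult u ≤ s.deg u + 1
  info : InfoOK ε s
  slope : SlopeOK ε s.deg s.mult s.scanQ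

theorem length_le_outDegree {m : Fin n → Fin n → ℕ} {u : Fin n} {l : List (Fin n)}
    (h : l.Nodup) (hl : ∀ x ∈ l, 0 < m u x) : l.length ≤ outDegree m u := by
  rw [← List.toFinset_card_of_nodup h, Finset.card_eq_sum_ones]
  refine (Finset.sum_le_sum fun x hx => ?_).trans
    (Finset.sum_le_sum_of_subset (f := m u) (Finset.subset_univ l.toFinset))
  exact hl x (List.mem_toFinset.1 hx)

theorem Core.length_scanQ_le {ε : ℝ} {s : State n} (h : Core ε s) (u : Fin n) :
    (s.scanQ u).length ≤ outDegree s.mult u :=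
  length_le_outDegree (h.scan_nodup u) fun x hx => (h.scan_mem u x).1 hx

theorem Core.length_infoQ_le {ε : ℝ} {s : State n} (h : Core ε s) (u : Fin n) :
    (s.infoQ u).length ≤ outDegree s.mult u :=
  length_le_outDegree (h.info_nodup u) fun x hx => (h.info_mem u x).1 hx

theorem Core.ne_of_pos {ε : ℝ} {s : State n} (h : Core ε s) {u v : Fin n}
    (huv : 0 < s.mult u v) : u ≠ v := by
  rintro rfl
  rw [h.loopless] at huv
  exact absurd huv (lt_irrefl 0)

/-- Stated additively so that one identity serves both increments and decrements without truncated
subtraction. -/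
theorem outDegree_set₂_add (m : Fin n → Fin n → ℕ) (u v w : Fin n) (a : ℕ) :
    outDegree (set₂ m u v a) w + (if w = u then m u v else 0) =
      outDegree m w + (if w = u then a else 0) := by
  unfold outDegree
  by_cases hw : w = u
  · subst hw
    rw [← Finset.add_sum_erase _ _ (Finset.mem_univ v), ← Finset.add_sum_erase _ (m w)
      (Finset.mem_univ v)]
    have : ∑ x ∈ univ.erase v, set₂ m w v a w x = ∑ x ∈ univ.erase v, m w x :=
      Finset.sum_congr rfl fun x hx => by
        rw [set₂_apply, if_neg]; exact fun h => (Finset.mem_erase.1 hx).1 h.2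
    rw [this, set₂_apply]
    simp
    ring
  · simp [hw, set₂_apply]

/-! ### Elementary updates -/

/-- Here `m` is the table before the change. `wins` reads an entry and its transpose, so one changed
entry affects only the two directions that are refreshed. -/
theorem reround_out_iff (s : State n) {u v : Fin n} (huv : u ≠ v) (m : Fin n → Fin n → ℕ)
    (h : ∀ a x, x ∈ s.out a ↔ wins m a x)
    (hm : ∀ a x, ¬ (a = u ∧ x = v) → s.mult a x = m a x) (a x : Fin n) :
    x ∈ (reround s u v).out a ↔ wins s.mult a x := by
  have key : ¬ (a = u ∧ x = v) → ¬ (a = v ∧ x = u) → (wins s.mult a x ↔ wins m a x) := by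
    intro h1 h2
    unfold wins
    rw [hm a x h1, hm x a fun e => h2 ⟨e.2, e.1⟩]
  unfold reround
  by_cases hav : a = v
  · subst hav
    by_cases hxu : x = u
    · subst hxu
      simp only [Function.update_self]
      split_ifs with hw <;> simp [hw]
    · rw [key (by tauto) (by tauto), ← h]
      simp only [Function.update_self, Function.update_of_ne huv.symm]
      split_ifs <;> simp [hxu]
  · by_cases hau : a = u
    · subst hau
      by_cases hxv : x = v
      · subst hxv
        simp only [Function.update_self, Function.update_of_ne huv]
        split_ifs with hw <;> simp [hw]
      · rw [key (by tauto) (by tauto), ← h]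
        simp only [Function.update_self, Function.update_of_ne huv]
        split_ifs <;> simp [hxv]
    · rw [key (by tauto) (by tauto), ← h]
      simp [hau, hav]

section addArc

variable (ε : ℝ) (s : State n) (u v : Fin n)

theorem addArc_deg : (addArc ε s u v).deg = s.deg := by
  unfold addArc; split_ifs <;> rfl

theorem addArc_mult : (addArc ε s u v).mult = set₂ s.mult u v (s.mult u v + 1) := by
  unfold addArc; split_ifs <;> rfl

theorem addArc_out : (addArc ε s u v).out = (reround { s with
      mult := set₂ s.mult u v (s.mult u v + 1)
      steps := s.steps + 1 } u v).out := by
  unfold addArc; split_ifs <;> rfl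

theorem addArc_scanQ : (addArc ε s u v).scanQ = if s.mult u v = 0 then
    Function.update s.scanQ u (s.scanQ u ++ [v]) else s.scanQ := by
  unfold addArc; split_ifs <;> rfl

theorem addArc_infoQ : (addArc ε s u v).infoQ = if s.mult u v = 0 then
    Function.update s.infoQ u (s.infoQ u ++ [v]) else s.infoQ := by
  unfold addArc; split_ifs <;> rfl

theorem addArc_per : (addArc ε s u v).per = if s.mult u v = 0 then
    set₂ s.per v u (s.deg u) else s.per := by
  unfold addArc; split_ifs <;> rfl

theorem addArc_inB : (addArc ε s u v).inB = if s.mult u v = 0 then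
    Function.update s.inB v (bucketInsert (level ε (s.deg u)) u (s.inB v)) else s.inB := by
  unfold addArc; split_ifs <;> rfl

theorem addArc_steps_le : (addArc ε s u v).steps ≤
    s.steps + 7 + headWalkLength (level ε (s.deg u)) (s.inB v) := by
  unfold addArc; split_ifs <;> simp [reround] <;> omega

theorem addArc_mult_pos (x y : Fin n) :
    0 < (addArc ε s u v).mult x y ↔ 0 < s.mult x y ∨ (x = u ∧ y = v) := by
  rw [addArc_mult, set₂_apply]
  split_ifs with h
  · simp [h]
  · simp [h]

end addArc

theorem Core.addArc {ε : ℝ} {s : State n} (h : Core ε s) {u v : Fin n} (huv : u ≠ v) :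
    Core ε (addArc ε s u v) where
  loopless x := by
    rw [addArc_mult, set₂_apply, if_neg, h.loopless]
    rintro ⟨rfl, e⟩; exact huv e
  out_iff a x := by
    rw [addArc_out, addArc_mult]
    exact reround_out_iff { s with
      mult := set₂ s.mult u v (s.mult u v + 1)
      steps := s.steps + 1 } huv s.mult h.out_iff
      (fun a x hax => by simp only [set₂_apply, if_neg hax]) a x
  scan_nodup x := by
    rw [addArc_scanQ]
    split_ifs with h0
    · by_cases hx : x = u
      · subst hx
        simp only [Function.update_self]
        refine List.nodup_append.2 ⟨h.scan_nodup x, by simp, fun a ha b hb => ?_⟩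
        rintro rfl
        rw [List.mem_singleton] at hb
        subst hb
        rw [h.scan_mem] at ha; omega
      · simpa [hx] using h.scan_nodup x
    · exact h.scan_nodup x
  scan_mem x y := by
    rw [addArc_mult_pos, addArc_scanQ, ← h.scan_mem]
    split_ifs with h0
    · by_cases hx : x = u
      · subst hx; simp
      · simp [hx]
    · refine ⟨Or.inl, ?_⟩
      rintro (h1 | ⟨rfl, rfl⟩)
      · exact h1
      · exact (h.scan_mem _ _).2 (Nat.pos_of_ne_zero h0)
  info_nodup x := by
    rw [addArc_infoQ]
    split_ifs with h0
    · by_cases hx : x = u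
      · subst hx
        simp only [Function.update_self]
        refine List.nodup_append.2 ⟨h.info_nodup x, by simp, fun a ha b hb => ?_⟩
        rintro rfl
        rw [List.mem_singleton] at hb
        subst hb
        rw [h.info_mem] at ha; omega
      · simpa [hx] using h.info_nodup x
    · exact h.info_nodup x
  info_mem x y := by
    rw [addArc_mult_pos, addArc_infoQ, ← h.info_mem]
    split_ifs with h0
    · by_cases hx : x = u
      · subst hx; simp
      · simp [hx]
    · refine ⟨Or.inl, ?_⟩
      rintro (h1 | ⟨rfl, rfl⟩)
      · exact h1
      · exact (h.info_mem _ _).2 (Nat.pos_of_ne_zero h0)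
  buckets y := by
    simp only [addArc_mult_pos]
    rw [addArc_inB, addArc_per]
    split_ifs with h0
    · by_cases hy : y = v
      · subst hy
        rw [Function.update_self]
        refine ((h.buckets y).insert (w := u) (by omega) (level ε (s.deg u))).congr
          (fun w => by simp) fun w _ => ?_
        rw [set₂_apply]
        by_cases hw : w = u
        · subst hw; simp
        · simp [hw]
      · rw [Function.update_of_ne hy]
        exact (h.buckets y).congr (fun w => by simp [hy]) fun w _ => by
          rw [set₂_apply, if_neg (by tauto)]
    · refine (h.buckets y).congr (fun w => ⟨?_, Or.inl⟩) fun w _ => rfl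
      rintro (h1 | ⟨rfl, rfl⟩)
      · exact h1
      · exact Nat.pos_of_ne_zero h0

theorem Inv.addArc {ε : ℝ} {s : State n} (h : Inv ε s) {u v : Fin n} (huv : u ≠ v)
    (hu : outDegree s.mult u ≤ s.deg u) (hd : (s.deg u : ℝ) ≤ slopeBound ε (s.deg v)) :
    Inv ε (addArc ε s u v) where
  toCore := h.toCore.addArc huv
  sum_le w := by
    have := outDegree_set₂_add s.mult u v w (s.mult u v + 1)
    rw [addArc_mult, addArc_deg]
    have := h.sum_le w
    split_ifs at * with hw
    · subst hw; omega
    · omega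
  info a w haw := by
    rw [addArc_mult_pos] at haw
    rw [addArc_deg, addArc_per, addArc_infoQ]
    split_ifs with h0
    · by_cases hc : a = u ∧ w = v
      · obtain ⟨rfl, rfl⟩ := hc
        -- The position of the appended element is the old length of the list, which the out-degree
        -- before the addition bounds.
        refine ⟨0, by simp [set₂_apply], by simp [set₂_apply], ?_⟩
        have h1 : w ∉ s.infoQ a := by rw [h.info_mem]; omega
        have h2 := h.length_infoQ_le a
        rw [Function.update_self, List.idxOf_append_of_notMem h1]
        simp; omega
      · have hpos : 0 < s.mult a w := by tauto
        obtain ⟨t, h1, h2, h3⟩ := h.info a w hpos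
        refine ⟨t, ?_, ?_, ?_⟩
        · rwa [set₂_apply, if_neg (by tauto)]
        · rwa [set₂_apply, if_neg (by tauto)]
        · by_cases ha : a = u
          · subst ha
            rwa [Function.update_self, List.idxOf_append_of_mem ((h.info_mem _ _).2 hpos)]
          · rwa [Function.update_of_ne ha]
    · refine h.info a w ?_
      rcases haw with h1 | ⟨rfl, rfl⟩
      · exact h1
      · exact Nat.pos_of_ne_zero h0
  slope a w haw := by
    rw [addArc_mult_pos] at haw
    rw [addArc_deg, addArc_scanQ]
    split_ifs with h0
    · by_cases hc : a = u ∧ w = v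
      · obtain ⟨rfl, rfl⟩ := hc
        refine ⟨0, by simpa using hd, ?_⟩
        have h1 : w ∉ s.scanQ a := by rw [h.scan_mem]; omega
        have h2 := h.length_scanQ_le a
        rw [Function.update_self, List.idxOf_append_of_notMem h1]
        simp; omega
      · have hpos : 0 < s.mult a w := by tauto
        obtain ⟨t, h1, h3⟩ := h.slope a w hpos
        refine ⟨t, h1, ?_⟩
        by_cases ha : a = u
        · subst ha
          rwa [Function.update_self, List.idxOf_append_of_mem ((h.scan_mem _ _).2 hpos)]
        · rwa [Function.update_of_ne ha]
    · refine h.slope a w ?_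
      rcases haw with h1 | ⟨rfl, rfl⟩
      · exact h1
      · exact Nat.pos_of_ne_zero h0

section removeArc

variable (ε : ℝ) (s : State n) (u v : Fin n)

theorem removeArc_deg : (removeArc ε s u v).deg = s.deg := by
  unfold removeArc; split_ifs <;> rfl

theorem removeArc_mult : (removeArc ε s u v).mult = set₂ s.mult u v (s.mult u v - 1) := by
  unfold removeArc; split_ifs <;> rfl

theorem removeArc_out : (removeArc ε s u v).out = (reround { s with
      mult := set₂ s.mult u v (s.mult u v - 1)
      steps := s.steps + 1 } u v).out := by
  unfold removeArc; split_ifs <;> rfl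

theorem removeArc_scanQ : (removeArc ε s u v).scanQ = if s.mult u v = 1 then
    Function.update s.scanQ u ((s.scanQ u).erase v) else s.scanQ := by
  unfold removeArc; split_ifs <;> rfl

theorem removeArc_infoQ : (removeArc ε s u v).infoQ = if s.mult u v = 1 then
    Function.update s.infoQ u ((s.infoQ u).erase v) else s.infoQ := by
  unfold removeArc; split_ifs <;> rfl

theorem removeArc_per : (removeArc ε s u v).per = s.per := by
  unfold removeArc; split_ifs <;> rfl

theorem removeArc_inB : (removeArc ε s u v).inB = if s.mult u v = 1 then
    Function.update s.inB v (bucketErase (level ε (s.per v u)) u (s.inB v)) else s.inB := by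
  unfold removeArc; split_ifs <;> rfl

theorem removeArc_steps_le : (removeArc ε s u v).steps ≤ s.steps + 6 := by
  unfold removeArc; split_ifs <;> simp [reround]

theorem removeArc_mult_pos (x y : Fin n) : 0 < (removeArc ε s u v).mult x y ↔
    0 < s.mult x y ∧ ¬ (s.mult u v = 1 ∧ x = u ∧ y = v) := by
  rw [removeArc_mult, set₂_apply]
  split_ifs with h
  · obtain ⟨rfl, rfl⟩ := h
    simp; omega
  · simp [h]

end removeArc

theorem Core.removeArc {ε : ℝ} {s : State n} (h : Core ε s) {u v : Fin n}
    (hpos : 0 < s.mult u v) : Core ε (removeArc ε s u v) where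
  loopless x := by
    have := h.ne_of_pos hpos
    rw [removeArc_mult, set₂_apply, if_neg, h.loopless]
    rintro ⟨rfl, e⟩; exact this e
  out_iff a x := by
    rw [removeArc_out, removeArc_mult]
    exact reround_out_iff { s with
      mult := set₂ s.mult u v (s.mult u v - 1)
      steps := s.steps + 1 } (h.ne_of_pos hpos) s.mult h.out_iff
      (fun a x hax => by simp only [set₂_apply, if_neg hax]) a x
  scan_nodup x := by
    rw [removeArc_scanQ]
    split_ifs with h0
    · by_cases hx : x = u
      · subst hx
        simpa using (h.scan_nodup x).erase v
      · simpa [hx] using h.scan_nodup x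
    · exact h.scan_nodup x
  scan_mem x y := by
    rw [removeArc_mult_pos, removeArc_scanQ, ← h.scan_mem]
    split_ifs with h0
    · by_cases hx : x = u
      · subst hx
        simp only [Function.update_self, (h.scan_nodup x).mem_erase_iff]
        tauto
      · simp [hx]
    · tauto
  info_nodup x := by
    rw [removeArc_infoQ]
    split_ifs with h0
    · by_cases hx : x = u
      · subst hx
        simpa using (h.info_nodup x).erase v
      · simpa [hx] using h.info_nodup x
    · exact h.info_nodup x
  info_mem x y := by
    rw [removeArc_mult_pos, removeArc_infoQ, ← h.info_mem]
    split_ifs with h0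
    · by_cases hx : x = u
      · subst hx
        simp only [Function.update_self, (h.info_nodup x).mem_erase_iff]
        tauto
      · simp [hx]
    · tauto
  buckets y := by
    simp only [removeArc_mult_pos]
    rw [removeArc_inB, removeArc_per]
    split_ifs with h0
    · by_cases hy : y = v
      · subst hy
        rw [Function.update_self]
        exact ((h.buckets y).erase u).congr (fun w => by simp [h0]) fun w _ => rfl
      · rw [Function.update_of_ne hy]
        exact (h.buckets y).congr (fun w => by simp [hy]) fun w _ => rfl
    · exact (h.buckets y).congr (fun w => by tauto) fun w _ => rfl

/-- Erasing from a circular list never moves another element away from the pointer, so the old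
values of t still serve. -/
theorem Inv.removeArc {ε : ℝ} {s : State n} (h : Inv ε s) {u v : Fin n}
    (hpos : 0 < s.mult u v) : Inv ε (removeArc ε s u v) where
  toCore := h.toCore.removeArc hpos
  sum_le w := by
    have := outDegree_set₂_add s.mult u v w (s.mult u v - 1)
    rw [removeArc_mult, removeArc_deg]
    have := h.sum_le w
    split_ifs at * with hw
    · subst hw; omega
    · omega
  info a w haw := by
    rw [removeArc_mult_pos] at haw
    obtain ⟨t, h1, h2, h3⟩ := h.info a w haw.1
    rw [removeArc_deg, removeArc_per, removeArc_infoQ]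
    refine ⟨t, h1, h2, le_trans ?_ h3⟩
    split_ifs with h0
    · by_cases ha : a = u
      · subst ha
        have : w ≠ v := by tauto
        simpa using idxOf_erase_le (s.infoQ a) this
      · simp [ha]
    · exact le_rfl
  slope a w haw := by
    rw [removeArc_mult_pos] at haw
    obtain ⟨t, h1, h3⟩ := h.slope a w haw.1
    rw [removeArc_deg, removeArc_scanQ]
    refine ⟨t, h1, le_trans ?_ h3⟩
    split_ifs with h0
    · by_cases ha : a = u
      · subst ha
        have : w ≠ v := by tauto
        simpa using idxOf_erase_le (s.scanQ a) this
      · simp [ha]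
    · exact le_rfl

theorem Core.updatePerceived {ε : ℝ} {s : State n} (h : Core ε s) {u v : Fin n}
    (hpos : 0 < s.mult u v) : Core ε (updatePerceived ε s v u) where
  loopless := h.loopless
  out_iff := h.out_iff
  scan_nodup := h.scan_nodup
  scan_mem := h.scan_mem
  info_nodup := h.info_nodup
  info_mem := h.info_mem
  buckets y := by
    simp only [DynOrient.updatePerceived]
    by_cases hy : y = v
    · subst hy
      rw [Function.update_self]
      refine (((h.buckets y).erase u).insert (w := u) (by simp) (level ε (s.deg u))).congr
        (fun w => ?_) fun w _ => ?_
      · by_cases hw : w = u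
        · subst hw; simp [hpos]
        · simp [hw]
      · rw [set₂_apply]
        by_cases hw : w = u
        · subst hw; simp
        · simp [hw]
    · rw [Function.update_of_ne hy]
      refine (h.buckets y).congr (fun w => Iff.rfl) fun w _ => ?_
      rw [set₂_apply, if_neg (by tauto)]

theorem Core.updatePerceived_steps_le {ε : ℝ} (hε : 0 < ε) {s : State n} (h : Core ε s)
    {u v : Fin n} {c : ℕ} (hc : Close ε c (s.per v u) (s.deg u)) :
    ((DynOrient.updatePerceived ε s v u).tick 1).steps ≤ s.steps + (c + 5) := by
  have := (h.buckets v).walkLength_le hε hc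
  simp only [DynOrient.updatePerceived, State.tick]
  omega

theorem Core.tick {ε : ℝ} {s : State n} (h : Core ε s) (c : ℕ) : Core ε (s.tick c) :=
  ⟨h.loopless, h.out_iff, h.scan_nodup, h.scan_mem, h.info_nodup, h.info_mem, h.buckets⟩

theorem Inv.tick {ε : ℝ} {s : State n} (h : Inv ε s) (c : ℕ) : Inv ε (s.tick c) :=
  ⟨h.toCore.tick c, h.sum_le, h.info, h.slope⟩

theorem Core.update_scanQ {ε : ℝ} {s : State n} (h : Core ε s) (u : Fin n) {L : List (Fin n)}
    (hL : L.Perm (s.scanQ u)) : Core ε { s with scanQ := Function.update s.scanQ u L } where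
  loopless := h.loopless
  out_iff := h.out_iff
  scan_nodup x := by
    by_cases hx : x = u
    · subst hx; simpa using hL.nodup_iff.2 (h.scan_nodup x)
    · simpa [hx] using h.scan_nodup x
  scan_mem x y := by
    by_cases hx : x = u
    · subst hx; simpa [hL.mem_iff] using h.scan_mem x y
    · simpa [hx] using h.scan_mem x y
  info_nodup := h.info_nodup
  info_mem := h.info_mem
  buckets := h.buckets

theorem Core.update_infoQ {ε : ℝ} {s : State n} (h : Core ε s) (u : Fin n) {L : List (Fin n)}
    (hL : L.Perm (s.infoQ u)) : Core ε { s with infoQ := Function.update s.infoQ u L } where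
  loopless := h.loopless
  out_iff := h.out_iff
  scan_nodup := h.scan_nodup
  scan_mem := h.scan_mem
  info_nodup x := by
    by_cases hx : x = u
    · subst hx; simpa using hL.nodup_iff.2 (h.info_nodup x)
    · simpa [hx] using h.info_nodup x
  info_mem x y := by
    by_cases hx : x = u
    · subst hx; simpa [hL.mem_iff] using h.info_mem x y
    · simpa [hx] using h.info_mem x y
  buckets := h.buckets

/-- The loop in which `u` informs the vertices in `T`. -/
noncomputable def informAll (ε : ℝ) (u : Fin n) (T : List (Fin n)) (s : State n) : State n :=
  T.foldl (fun t w => (updatePerceived ε t w u).tick 1) s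

theorem informAll_fields (ε : ℝ) (u : Fin n) (T : List (Fin n)) (s : State n) :
    (informAll ε u T s).deg = s.deg ∧ (informAll ε u T s).mult = s.mult ∧
    (informAll ε u T s).scanQ = s.scanQ ∧ (informAll ε u T s).infoQ = s.infoQ ∧
    ∀ x y, (informAll ε u T s).per x y = if y = u ∧ x ∈ T then s.deg u else s.per x y := by
  induction T generalizing s with
  | nil => simp [informAll]
  | cons w T ih =>
    obtain ⟨h1, h2, h3, h4, h5⟩ := ih ((updatePerceived ε s w u).tick 1)
    refine ⟨h1, h2, h3, h4, fun x y => (h5 x y).trans ?_⟩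
    simp only [State.tick, updatePerceived, set₂_apply, List.mem_cons]
    split_ifs <;> first | rfl | tauto

/-- Distinctness of the list keeps `hc` usable: informing one vertex leaves the values stored at the
later ones untouched. -/
theorem Core.informAll {ε : ℝ} (hε : 0 < ε) {c : ℕ} {u : Fin n} {T : List (Fin n)}
    {s : State n} (h : Core ε s) (hT : T.Nodup) (hpos : ∀ w ∈ T, 0 < s.mult u w)
    (hc : ∀ w ∈ T, Close ε c (s.per w u) (s.deg u)) :
    Core ε (informAll ε u T s) ∧ (DynOrient.informAll ε u T s).steps ≤
      s.steps + (c + 5) * T.length := by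
  induction T generalizing s with
  | nil => exact ⟨h, by simp [DynOrient.informAll]⟩
  | cons w T ih =>
    rw [List.nodup_cons] at hT
    rw [List.forall_mem_cons] at hpos hc
    obtain ⟨h1, h2⟩ := ih (s := (DynOrient.updatePerceived ε s w u).tick 1)
      ((h.updatePerceived hpos.1).tick 1) hT.2 hpos.2 fun x hx => by
        simp only [State.tick, DynOrient.updatePerceived, set₂_apply]
        rw [if_neg]
        · exact hc.2 x hx
        · rintro ⟨rfl, -⟩; exact hT.1 hx
    refine ⟨h1, h2.trans ?_⟩
    have := h.updatePerceived_steps_le hε hc.1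
    rw [List.length_cons]
    linarith

/-- Either t = 0 and the stored value is off by at most one, or d is at least about 127/ε. In the
second case the error t + 1 is covered by the factor (1 + ε/64)², that is, by two levels. Hence each
walk passes a bounded number of buckets. -/
theorem close_of_changes {ε : ℝ} (hε : Small ε) {d d' p t : ℕ} (h1 : d ≤ p + t)
    (h2 : p ≤ d + t) (h3 : (batch ε - 1) * t ≤ d) (h4 : d ≤ d' + 1) (h5 : d' ≤ d + 1) :
    Close ε 2 p d' := by
  obtain ⟨κ, hκ, hκ1, -⟩ := hε.batch
  obtain ⟨hε0, hε1⟩ := hε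
  rw [hκ, Nat.add_sub_cancel] at h3
  rcases Nat.eq_zero_or_pos t with rfl | ht
  · left; omega
  right
  have ht' : (1 : ℝ) ≤ t := by exact_mod_cast ht
  have h3' : (κ : ℝ) * t ≤ d := by exact_mod_cast h3
  have h1' : (d : ℝ) ≤ p + t := by exact_mod_cast h1
  have h2' : (p : ℝ) ≤ d + t := by exact_mod_cast h2
  have h4' : (d : ℝ) ≤ d' + 1 := by exact_mod_cast h4
  have h5' : (d' : ℝ) ≤ d + 1 := by exact_mod_cast h5
  have hd : 127 * (t : ℝ) ≤ ε * d := by nlinarith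
  have hd0 : 0 < (d : ℝ) := by
    by_contra h; nlinarith
  have hp : 0 < (p : ℝ) := by nlinarith
  have hd0' : 0 < (d' : ℝ) := by nlinarith
  constructor
  · refine level_le_add hε0 (by exact_mod_cast hd0') ?_
    have e1 : ε * d ≤ ε * d' + ε := by nlinarith
    nlinarith [mul_nonneg (sq_nonneg ε) hd0'.le]
  · refine level_le_add hε0 (by exact_mod_cast hp) ?_
    have e1 : ε * d ≤ ε * p + ε * t := by nlinarith
    nlinarith [mul_nonneg (sq_nonneg ε) hp.le]

section setDegree

variable (ε : ℝ) (s : State n) (u : Fin n) (d : ℕ)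

theorem setDegree_deg : (setDegree ε s u d).deg = Function.update s.deg u d :=
  (informAll_fields ε u _ { s with deg := Function.update s.deg u d, steps := s.steps + 1 }).1

theorem setDegree_mult : (setDegree ε s u d).mult = s.mult :=
  (informAll_fields ε u _ { s with deg := Function.update s.deg u d, steps := s.steps + 1 }).2.1

theorem setDegree_scanQ : (setDegree ε s u d).scanQ = s.scanQ :=
  (informAll_fields ε u _ { s with deg := Function.update s.deg u d, steps := s.steps + 1 }).2.2.1

theorem setDegree_infoQ : (setDegree ε s u d).infoQ = Function.update s.infoQ u
    ((s.infoQ u).rotate (min (batch ε) (s.infoQ u).length)) := by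
  show Function.update _ u _ = _
  congr 1
  exact (informAll_fields ε u _
    { s with deg := Function.update s.deg u d, steps := s.steps + 1 }).2.2.2.1

theorem setDegree_per (x y : Fin n) : (setDegree ε s u d).per x y =
    if y = u ∧ x ∈ (s.infoQ u).take (min (batch ε) (s.infoQ u).length) then d else s.per x y := by
  refine ((informAll_fields ε u _
    { s with deg := Function.update s.deg u d, steps := s.steps + 1 }).2.2.2.2 x y).trans ?_
  simp

end setDegree

/-- The slope condition is a hypothesis because increments and decrements need different arguments;
the informing round is the same for both. -/
theorem Inv.setDegree {ε : ℝ} (hε : Small ε) {s : State n} (h : Inv ε s) {u : Fin n} {d : ℕ}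
    (h1 : s.deg u ≤ d + 1) (h2 : d ≤ s.deg u + 1) (hu : outDegree s.mult u ≤ d)
    (hs : SlopeOK ε (Function.update s.deg u d) s.mult s.scanQ) :
    Inv ε (setDegree ε s u d) ∧ (DynOrient.setDegree ε s u d).steps ≤
      s.steps + 1 + 7 * DynOrient.batch ε := by
  set c := min (DynOrient.batch ε) (s.infoQ u).length with hc
  have hclose : ∀ w ∈ (s.infoQ u).take c, Close ε 2 (s.per w u) d := by
    intro w hw
    obtain ⟨t, e1, e2, e3⟩ := h.info u w ((h.info_mem _ _).1 (List.mem_of_mem_take hw))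
    exact close_of_changes hε e1 e2 (by omega) h1 h2
  obtain ⟨hcore, hsteps⟩ := Core.informAll hε.1 (c := 2) (u := u) (T := (s.infoQ u).take c)
    (s := { s with deg := Function.update s.deg u d, steps := s.steps + 1 })
    ⟨h.loopless, h.out_iff, h.scan_nodup, h.scan_mem, h.info_nodup, h.info_mem, h.buckets⟩
    ((List.take_sublist _ _).nodup (h.info_nodup u))
    (fun w hw => (h.info_mem _ _).1 (List.mem_of_mem_take hw)) (by simpa using hclose)
  have hcl : c ≤ (s.infoQ u).length := min_le_right _ _
  refine ⟨⟨?_, ?_, ?_, ?_⟩, ?_⟩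
  · refine hcore.update_infoQ u ?_
    rw [(informAll_fields ε u _ _).2.2.2.1]
    exact List.rotate_perm _ _
  · intro w
    rw [setDegree_mult, setDegree_deg]
    by_cases hw : w = u
    · subst hw; simp; omega
    · simpa [hw] using h.sum_le w
  · intro a w haw
    rw [setDegree_mult] at haw
    rw [setDegree_deg, setDegree_per, setDegree_infoQ]
    by_cases ha : a = u
    · subst ha
      have hmem := (h.info_mem _ _).2 haw
      have hnd := h.info_nodup a
      have hlen := h.length_infoQ_le a
      simp only [Function.update_self, ← hc, List.rotate_eq_drop_append_take hcl, true_and]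
      rw [← List.take_append_drop c (s.infoQ a)] at hmem hnd
      by_cases hw : w ∈ (s.infoQ a).take c
      · rw [if_pos hw]
        refine ⟨0, le_rfl, le_rfl, ?_⟩
        have : ((s.infoQ a).drop c ++ (s.infoQ a).take c).idxOf w <
            ((s.infoQ a).drop c ++ (s.infoQ a).take c).length :=
          List.idxOf_lt_length_iff.2 (List.mem_append_right _ hw)
        rw [List.length_append, List.length_drop, List.length_take] at this
        omega
      · rw [if_neg hw]
        have hwd : w ∈ (s.infoQ a).drop c := (List.mem_append.1 hmem).resolve_left hw
        have hck : c = DynOrient.batch ε := by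
          have := List.length_pos_of_mem hwd
          rw [List.length_drop] at this
          omega
        obtain ⟨t, e1, e2, e3⟩ := h.info a w haw
        rw [← List.take_append_drop c (s.infoQ a), List.idxOf_append_of_notMem hw,
          List.length_take, min_eq_left hcl] at e3
        -- The vertex was not reached, so the pointer advanced by the full k towards it. This pays
        -- the k - 1 for the new change and leaves one unit for a decrement of the degree.
        refine ⟨t + 1, by omega, by omega, ?_⟩
        rw [List.idxOf_append_of_mem hwd, mul_add, mul_one]
        obtain ⟨κ, hκ, -⟩ := hε.batch
        omega
    · rw [if_neg (by tauto), Function.update_of_ne ha, Function.update_of_ne ha]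
      exact h.info a w haw
  · rw [setDegree_mult, setDegree_deg, setDegree_scanQ]
    exact hs
  · refine hsteps.trans ?_
    rw [List.length_take]
    have : min c (s.infoQ u).length ≤ DynOrient.batch ε := by omega
    simp only
    nlinarith


/-! ### Consequences of the invariant -/

/-- The unscanned increments satisfy t ≤ ε d / 127, and (1 + 3ε/4) / (1 - ε/127) ≤ 1 + ε. -/
theorem Inv.arc_le {ε : ℝ} (hε : Small ε) {s : State n} (h : Inv ε s) {u x : Fin n}
    (hux : 0 < s.mult u x) :
    (s.deg u : ℝ) ≤ max ((1 + ε) * s.deg x) (s.deg x + 1) := by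
  obtain ⟨κ, hκ, hκ1, -⟩ := hε.batch
  obtain ⟨hε0, hε1⟩ := hε
  obtain ⟨t, h1, h2⟩ := h.slope u x hux
  rw [hκ, Nat.add_sub_cancel] at h2
  have hx0 : (0 : ℝ) ≤ s.deg x := Nat.cast_nonneg _
  rcases Nat.eq_zero_or_pos t with rfl | ht
  · rw [Nat.cast_zero, add_zero] at h1
    refine h1.trans (max_le_max ?_ le_rfl)
    nlinarith
  have ht' : (1 : ℝ) ≤ t := by exact_mod_cast ht
  have h2' : (κ : ℝ) * t ≤ s.deg u := by
    have : κ * t ≤ s.deg u := by omega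
    exact_mod_cast this
  have h3 : 127 * (t : ℝ) ≤ ε * s.deg u := by nlinarith
  refine le_max_of_le_left ?_
  unfold slopeBound at h1
  -- The additive alternative is impossible when t ≥ 1: it needs ε d(x) ≤ 4/3, whereas t ≥ 1 forces
  -- ε d(u) ≥ 127.
  rcases le_total ((1 + 3 * ε / 4) * s.deg x) (s.deg x + 1 : ℝ) with hm | hm
  · rw [max_eq_right hm] at h1
    exfalso
    nlinarith
  · rw [max_eq_left hm] at h1
    have : (s.deg u : ℝ) * (1 - ε / 127) ≤ (1 + 3 * ε / 4) * s.deg x := by nlinarith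
    by_contra hc
    push Not at hc
    nlinarith [mul_nonneg hε0.le hx0, mul_nonneg (mul_nonneg hε0.le hε0.le) hx0]

theorem one_add_pow_three_le {ε : ℝ} (hε : 0 < ε) : (1 + ε) ^ 3 ≤ (1 + ε / 64) ^ 192 := by
  have hB : 1 + ε ≤ (1 + ε / 64) ^ 64 := by
    have := one_add_mul_le_pow (a := ε / 64) (by linarith) 64
    push_cast at this
    linarith
  calc (1 + ε) ^ 3 ≤ ((1 + ε / 64) ^ 64) ^ 3 := by gcongr
    _ = (1 + ε / 64) ^ 192 := by norm_num [← pow_mul]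

/-- Used when an arc y → a is turned into a → y. From d(a) to d(y), on to an in-neighbour of y and
then to its perceived value are three factors 1 + ε, hence at most 192 levels. So only the outermost
call of a recursion can face a long walk from the head. -/
theorem Inv.headWalkLength_le {ε : ℝ} (hε : Small ε) {s : State n} (h : Inv ε s) {a y : Fin n}
    (hy : (s.deg y : ℝ) ≤ max ((1 + ε) * s.deg a) (s.deg a + 1)) :
    headWalkLength (level ε (s.deg a)) (s.inB y) ≤ 200 := by
  have hε' := hε
  obtain ⟨κ, hκ, hκ1, -⟩ := hε.batch
  obtain ⟨hε0, hε1⟩ := hε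
  have ha0 : (0 : ℝ) ≤ s.deg a := Nat.cast_nonneg _
  -- For small degrees each arc adds at most one and the perceived values are exact, so values are
  -- counted instead of levels.
  rcases lt_or_ge (ε * s.deg a) 1 with ha | ha
  · have hy' : s.deg y ≤ s.deg a + 1 := by
      rw [max_eq_right (by linarith)] at hy
      exact_mod_cast hy
    have hyr : (s.deg y : ℝ) ≤ s.deg a + 1 := by exact_mod_cast hy'
    refine (((h.buckets y).headWalkLength_le hε0 (p := s.deg a) (q := s.deg a + 2) (by omega)
      fun w hw => ?_).1).trans (by omega)
    have hwy : s.deg w ≤ s.deg y + 1 := by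
      have := h.arc_le hε' hw
      have h2 : (s.deg w : ℝ) < (s.deg y + 1 + 1 : ℕ) := by
        push_cast
        refine this.trans_lt (max_lt ?_ (by linarith))
        nlinarith
      have := Nat.cast_lt.1 h2
      omega
    obtain ⟨t, -, h2, h3⟩ := h.info w y hw
    rw [hκ, Nat.add_sub_cancel] at h3
    rcases Nat.eq_zero_or_pos t with rfl | ht
    · omega
    exfalso
    have : κ ≤ s.deg a + 2 := by nlinarith
    have : (κ : ℝ) ≤ s.deg a + 2 := by exact_mod_cast this
    nlinarith
  · have hpos : 0 < s.deg a := by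
      rcases Nat.eq_zero_or_pos (s.deg a) with h0 | h0
      · rw [h0] at ha; norm_num at ha
      · exact h0
    obtain ⟨R, hR, hR1, hR3⟩ : ∃ R : ℝ, R = (1 + ε / 64) ^ 192 ∧ 1 ≤ R ∧ (1 + ε) ^ 3 ≤ R :=
      ⟨_, rfl, one_le_pow₀ (by linarith), one_add_pow_three_le hε0⟩
    have hQ : ((⌊R * s.deg a⌋₊ : ℕ) : ℝ) ≤ R * s.deg a := Nat.floor_le (by positivity)
    have haQ : s.deg a ≤ ⌊R * s.deg a⌋₊ := Nat.le_floor (le_mul_of_one_le_left ha0 hR1)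
    rw [hR] at hQ
    have hl := level_le_add hε0 hpos hQ
    rw [← hR] at hl
    clear hQ hR
    refine (((h.buckets y).headWalkLength_le hε0 haQ fun w hw => ?_).2).trans (by omega)
    refine Nat.le_floor (le_trans ?_ (mul_le_mul_of_nonneg_right hR3 ha0))
    have hw1 := h.arc_le hε' hw
    obtain ⟨t, -, h2, h3⟩ := h.info w y hw
    rw [hκ, Nat.add_sub_cancel] at h3
    have h3' : (κ : ℝ) * t ≤ s.deg w := by
      have : κ * t ≤ s.deg w := by omega
      exact_mod_cast this
    have h2' : (s.per y w : ℝ) ≤ s.deg w + t := by exact_mod_cast h2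
    have ht0 : (0 : ℝ) ≤ t := Nat.cast_nonneg _
    have h4 : 127 * (t : ℝ) ≤ ε * s.deg w := by nlinarith
    rw [max_eq_left (by linarith)] at hy
    have hw2 : (s.deg w : ℝ) ≤ (1 + ε) ^ 2 * s.deg a := by
      refine hw1.trans (max_le ?_ ?_)
      · nlinarith
      · nlinarith
    calc (s.per y w : ℝ) ≤ (1 + ε) * s.deg w := by
          have : (0 : ℝ) ≤ s.deg w := Nat.cast_nonneg _
          nlinarith
      _ ≤ (1 + ε) * ((1 + ε) ^ 2 * s.deg a) := by gcongr
      _ = _ := by ring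

/-- Every out-degree is exact. -/
def Exact (s : State n) : Prop := ∀ u, outDegree s.mult u = s.deg u

/-- The indicator of `{a, c} = {u, v}`. -/
def pairInd (u v a c : Fin n) : ℕ := if (a = u ∧ c = v) ∨ (a = v ∧ c = u) then 1 else 0

theorem pairInd_comm (u v a c : Fin n) : pairInd u v a c = pairInd v u a c := by
  exact if_congr or_comm rfl rfl

theorem set₂_succ_add (m : Fin n → Fin n → ℕ) {u v : Fin n} (huv : u ≠ v) (a c : Fin n) :
    set₂ m u v (m u v + 1) a c + set₂ m u v (m u v + 1) c a =
      m a c + m c a + pairInd u v a c := by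
  simp only [set₂_apply, pairInd]
  by_cases h1 : a = u ∧ c = v
  · obtain ⟨rfl, rfl⟩ := h1
    simp [huv, huv.symm]; omega
  · by_cases h2 : a = v ∧ c = u
    · obtain ⟨rfl, rfl⟩ := h2
      simp [huv, huv.symm]; omega
    · simp [h1, h2]
      intro h3 h4; exact absurd ⟨h4, h3⟩ h2

theorem set₂_pred_add (m : Fin n → Fin n → ℕ) {u v : Fin n} (huv : u ≠ v) (hpos : 0 < m u v)
    (a c : Fin n) :
    set₂ m u v (m u v - 1) a c + set₂ m u v (m u v - 1) c a + pairInd u v a c =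
      m a c + m c a := by
  simp only [set₂_apply, pairInd]
  by_cases h1 : a = u ∧ c = v
  · obtain ⟨rfl, rfl⟩ := h1
    simp [huv, huv.symm]; omega
  · by_cases h2 : a = v ∧ c = u
    · obtain ⟨rfl, rfl⟩ := h2
      simp [huv, huv.symm]; omega
    · simp [h1, h2]
      intro h3 h4; exact absurd ⟨h4, h3⟩ h2

/-! ### The depth of the recursion -/

/-- A bound for the length of a chain of out-degrees, of which the largest is `d`. -/
noncomputable def depth (ε : ℝ) (d : ℕ) : ℝ :=
  min (d : ℝ) (batch ε) + Real.log (max (d : ℝ) (batch ε) / batch ε) / Real.log (1 + ε / 4)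

theorem depth_nonneg {ε : ℝ} (hε : Small ε) (d : ℕ) : 0 ≤ depth ε d := by
  obtain ⟨κ, hκ, -⟩ := hε.batch
  have hb : (0 : ℝ) < batch ε := by rw [hκ]; positivity
  unfold depth
  have h1 : 0 ≤ Real.log (max (d : ℝ) (batch ε) / batch ε) :=
    Real.log_nonneg ((one_le_div hb).2 (le_max_right _ _))
  have h2 : 0 ≤ Real.log (1 + ε / 4) := Real.log_nonneg (by linarith [hε.1])
  have : (0 : ℝ) ≤ min (d : ℝ) (batch ε) := le_min (Nat.cast_nonneg _) hb.le
  positivity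

theorem depth_mono {ε : ℝ} (hε : Small ε) {d e : ℕ} (h : d ≤ e) : depth ε d ≤ depth ε e := by
  obtain ⟨κ, hκ, -⟩ := hε.batch
  have hb : (0 : ℝ) < batch ε := by rw [hκ]; positivity
  have h' : (d : ℝ) ≤ e := by exact_mod_cast h
  have h2 : 0 ≤ Real.log (1 + ε / 4) := Real.log_nonneg (by linarith [hε.1])
  have hm : 0 < max (d : ℝ) (batch ε) / batch ε := div_pos (lt_of_lt_of_le hb (le_max_right _ _)) hb
  unfold depth
  gcongr

/-- Below k a unit step is charged to the first summand, even if it crosses the threshold, because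
the logarithm is nonnegative. From k on, a factor 1 + ε/4 is one unit of the logarithmic summand. -/
theorem depth_add_one_le {ε : ℝ} (hε : Small ε) {d e : ℕ} (h : d + 1 ≤ e)
    (h' : batch ε ≤ d → (1 + ε / 4) * d ≤ (e : ℝ)) : depth ε d + 1 ≤ depth ε e := by
  obtain ⟨κ, hκ, -⟩ := hε.batch
  have hb : (0 : ℝ) < batch ε := by rw [hκ]; positivity
  have hl : 0 < Real.log (1 + ε / 4) := Real.log_pos (by linarith [hε.1])
  have hde : (d : ℝ) + 1 ≤ e := by exact_mod_cast h
  rcases lt_or_ge d (batch ε) with hd | hd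
  · have hd' : (d : ℝ) + 1 ≤ batch ε := by exact_mod_cast hd
    have h1 : 0 ≤ Real.log (max (e : ℝ) (batch ε) / batch ε) :=
      Real.log_nonneg ((one_le_div hb).2 (le_max_right _ _))
    have h2 : (d : ℝ) + 1 ≤ min (e : ℝ) (batch ε) := le_min hde hd'
    unfold depth
    rw [min_eq_left (by linarith), max_eq_right (by linarith), div_self hb.ne', Real.log_one,
      zero_div, add_zero]
    have := div_nonneg h1 hl.le
    linarith
  · have hd' : (batch ε : ℝ) ≤ d := by exact_mod_cast hd
    have hd0 : (0 : ℝ) < d := hb.trans_le hd'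
    have h3 := h' hd
    unfold depth
    rw [min_eq_right hd', min_eq_right (by linarith), max_eq_left hd', max_eq_left (by linarith),
      add_assoc]
    gcongr
    rw [div_add_one hl.ne']
    gcongr
    rw [← Real.log_mul (by positivity) (by linarith [hε.1])]
    apply Real.log_le_log
    · have := hε.1
      positivity
    · rw [div_mul_eq_mul_div]
      gcongr
      linarith

/-! ### Scanning -/

/-- The two ways in which the test can fail correspond to the two arguments of the maximum. The
bound already allows for the coming increment. -/
theorem le_slopeBound_of_not_scanFlips {ε : ℝ} (hε : Small ε) {s : State n} {u x : Fin n}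
    (h : ¬ scanFlips ε s u x) : (s.deg u : ℝ) + 1 ≤ slopeBound ε (s.deg x) := by
  unfold scanFlips at h
  unfold slopeBound
  rw [not_and_or] at h
  have h0 : (0 : ℝ) ≤ s.deg x := Nat.cast_nonneg _
  rcases h with h | h
  · push Not at h
    refine h.trans ((?_ : _ ≤ _).trans (le_max_left _ _))
    have := hε.1
    nlinarith
  · have : (s.deg u : ℝ) ≤ s.deg x := by exact_mod_cast not_lt.1 h
    exact le_max_of_le_right (by linarith)

theorem Inv.scan_step {ε : ℝ} (hε : Small ε) {s : State n} (h : Inv ε s) {u x : Fin n}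
    {L : List (Fin n)} (hq : s.scanQ u = x :: L) (hx : ¬ scanFlips ε s u x) :
    Inv ε { (updatePerceived ε s x u).tick 1 with
      scanQ := Function.update ((updatePerceived ε s x u).tick 1).scanQ u (L ++ [x]) } ∧
    ((updatePerceived ε s x u).tick 1).steps ≤ s.steps + 7 := by
  have hpos : 0 < s.mult u x := by rw [← h.scan_mem, hq]; simp
  have hclose : Close ε 2 (s.per x u) (s.deg u) := by
    obtain ⟨t, e1, e2, e3⟩ := h.info u x hpos
    exact close_of_changes hε e1 e2 (by omega) (by omega) (by omega)
  refine ⟨⟨?_, h.sum_le, ?_, ?_⟩, h.updatePerceived_steps_le hε.1 hclose⟩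
  · refine ((h.updatePerceived hpos).tick 1).update_scanQ u ?_
    show (L ++ [x]).Perm (s.scanQ u)
    rw [hq]
    exact List.perm_append_singleton x L
  · intro a w haw
    show ∃ t, s.deg a ≤ set₂ s.per x u (s.deg u) w a + t ∧
      set₂ s.per x u (s.deg u) w a ≤ s.deg a + t ∧ (s.infoQ a).idxOf w + _ * t ≤ s.deg a
    rw [set₂_apply]
    split_ifs with hc
    · obtain ⟨rfl, rfl⟩ := hc
      -- During a scan the list may have one more element than the stored degree. A position is
      -- strictly below the length, so it is still at most the degree.
      refine ⟨0, le_rfl, le_rfl, ?_⟩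
      have h1 : (s.infoQ a).idxOf w < (s.infoQ a).length :=
        List.idxOf_lt_length_iff.2 ((h.info_mem _ _).2 haw)
      have h2 := h.length_infoQ_le a
      have h3 := h.sum_le a
      omega
    · exact h.info a w haw
  · intro a w haw
    show ∃ t : ℕ, (s.deg a : ℝ) ≤ slopeBound ε (s.deg w) + t ∧
      (Function.update s.scanQ u (L ++ [x]) a).idxOf w + _ * t ≤ s.deg a
    have haw' : 0 < s.mult a w := haw
    by_cases ha : a = u
    · subst ha
      rw [Function.update_self]
      have hnd := h.scan_nodup a
      rw [hq, List.nodup_cons] at hnd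
      by_cases hw : w = x
      · subst hw
        refine ⟨0, ?_, ?_⟩
        · have := le_slopeBound_of_not_scanFlips hε hx
          push_cast
          linarith
        · rw [List.idxOf_append_of_notMem hnd.1]
          have h2 := h.length_scanQ_le a
          have h3 := h.sum_le a
          rw [hq, List.length_cons] at h2
          simp
          omega
      · have hm : w ∈ L := by
          have := (h.scan_mem a w).2 haw'
          rw [hq] at this
          exact (List.mem_cons.1 this).resolve_left hw
        obtain ⟨t, e1, e2⟩ := h.slope a w haw'
        rw [hq, List.idxOf_cons_ne _ (Ne.symm hw)] at e2
        refine ⟨t, e1, ?_⟩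
        rw [List.idxOf_append_of_mem hm]
        omega
    · rw [Function.update_of_ne ha]
      exact h.slope a w haw'

theorem scan_spec {ε : ℝ} (hε : Small ε) (u : Fin n) (c : ℕ) {s : State n} (h : Inv ε s)
    (hc : c ≤ (s.scanQ u).length) :
    Inv ε (scan ε u c s).1 ∧ (scan ε u c s).1.deg = s.deg ∧ (scan ε u c s).1.mult = s.mult ∧
    (scan ε u c s).1.steps ≤ s.steps + 7 * c ∧
    (∀ x, (scan ε u c s).2 = some x → 0 < s.mult u x ∧ scanFlips ε s u x) ∧
    ((scan ε u c s).2 = none →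
      (scan ε u c s).1.scanQ = Function.update s.scanQ u ((s.scanQ u).rotate c) ∧
      ∀ x ∈ (s.scanQ u).take c, ¬ scanFlips ε s u x) := by
  induction c generalizing s with
  | zero => exact ⟨h, rfl, rfl, le_rfl, by simp [scan], by simp [scan]⟩
  | succ c ih =>
    cases hq : s.scanQ u with
    | nil => rw [hq] at hc; simp at hc
    | cons x L =>
      rw [hq, List.length_cons] at hc
      by_cases hx : scanFlips ε s u x
      · have hs : scan ε u (c + 1) s = (s.tick 1, some x) := by
          simp only [scan, hq, if_pos hx]
        rw [hs]
        refine ⟨h.tick 1, rfl, rfl, by simp [State.tick]; omega, ?_, by simp⟩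
        rintro y hy
        obtain rfl := Option.some.inj hy
        exact ⟨by rw [← h.scan_mem, hq]; simp, hx⟩
      · obtain ⟨h1, h2⟩ := h.scan_step hε hq hx
        set s₁ : State n := { (updatePerceived ε s x u).tick 1 with
          scanQ := Function.update ((updatePerceived ε s x u).tick 1).scanQ u (L ++ [x]) } with hs₁
        have hs : scan ε u (c + 1) s = scan ε u c s₁ := by
          simp only [scan, hq, if_neg hx]
          rfl
        have hq₁ : s₁.scanQ = Function.update s.scanQ u (L ++ [x]) := rfl
        obtain ⟨i1, i2, i3, i4, i5, i6⟩ := ih h1 (by rw [hq₁]; simp; omega)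
        rw [hs]
        refine ⟨i1, i2, i3, i4.trans ?_, i5, fun hn => ?_⟩
        · have : s₁.steps ≤ s.steps + 7 := h2
          omega
        · obtain ⟨j1, j2⟩ := i6 hn
          rw [hq₁, Function.update_self] at j1 j2
          refine ⟨?_, ?_⟩
          · rw [j1, Function.update_idem, List.rotate_cons_succ]
          · rw [List.take_succ_cons, List.forall_mem_cons]
            -- As c is at most the length of L, the vertex moved to the end is not scanned again.
            rw [List.take_append_of_le_length (by omega)] at j2
            exact ⟨hx, j2⟩

/-! ### Insertion of a copy -/

/-- The outcome of the insertion of a copy of `uv`. -/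
structure InsertPost (ε : ℝ) (s : State n) (u v : Fin n) (s' : State n) : Prop where
  inv : Inv ε s'
  exact : Exact s'
  deg_le : ∀ w, s'.deg w ≤ s.deg w + 1
  mult_add : ∀ a c, s'.mult a c + s'.mult c a = s.mult a c + s.mult c a + pairInd u v a c

/-- Scanned vertices restart at t = 0. Unscanned ones are k positions closer to the pointer, which
pays for raising t by one. Arcs into u only become flatter. -/
theorem slopeOK_increment {ε : ℝ} (hε : Small ε) {s s' : State n} (h : Inv ε s) (h' : Inv ε s')
    {u : Fin n} (hdeg : s'.deg = s.deg) (hmult : s'.mult = s.mult)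
    (hq : s'.scanQ = Function.update s.scanQ u
      ((s.scanQ u).rotate (min (batch ε) (s.scanQ u).length)))
    (hT : ∀ x ∈ (s.scanQ u).take (min (batch ε) (s.scanQ u).length), ¬ scanFlips ε s u x) :
    SlopeOK ε (Function.update s'.deg u (s'.deg u + 1)) s'.mult s'.scanQ := by
  intro a x hax
  have hne : x ≠ a := (h'.ne_of_pos hax).symm
  set c := min (batch ε) (s.scanQ u).length with hc
  have hcl : c ≤ (s.scanQ u).length := min_le_right _ _
  by_cases ha : a = u
  · subst ha
    rw [hmult] at hax
    rw [Function.update_self, Function.update_of_ne hne, hdeg]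
    have hmem := (h.scan_mem _ _).2 hax
    have hlen := h.length_scanQ_le a
    have hsum := h.sum_le a
    rw [hq, Function.update_self, List.rotate_eq_drop_append_take hcl]
    by_cases hx : x ∈ (s.scanQ a).take c
    · refine ⟨0, ?_, ?_⟩
      · have := le_slopeBound_of_not_scanFlips hε (hT x hx)
        push_cast
        linarith
      · have : ((s.scanQ a).drop c ++ (s.scanQ a).take c).idxOf x <
            ((s.scanQ a).drop c ++ (s.scanQ a).take c).length :=
          List.idxOf_lt_length_iff.2 (List.mem_append_right _ hx)
        rw [List.length_append, List.length_drop, List.length_take] at this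
        omega
    · rw [← List.take_append_drop c (s.scanQ a)] at hmem
      have hxd : x ∈ (s.scanQ a).drop c := (List.mem_append.1 hmem).resolve_left hx
      have hck : c = batch ε := by
        have := List.length_pos_of_mem hxd
        rw [List.length_drop] at this
        omega
      obtain ⟨t, e1, e3⟩ := h.slope a x hax
      rw [← List.take_append_drop c (s.scanQ a), List.idxOf_append_of_notMem hx,
        List.length_take, min_eq_left hcl] at e3
      refine ⟨t + 1, by push_cast; linarith, ?_⟩
      rw [List.idxOf_append_of_mem hxd, mul_add, mul_one]
      obtain ⟨κ, hκ, -⟩ := hε.batch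
      omega
  · obtain ⟨t, e1, e2⟩ := h'.slope a x hax
    rw [Function.update_of_ne ha]
    refine ⟨t, e1.trans (add_le_add_left (slopeBound_mono hε.1 ?_) _), e2⟩
    by_cases hx : x = u
    · subst hx; simp
    · simp [hx]

/-- Flipping u → x makes u exact again and passes the surplus to x, whose out-degree is smaller. So
d(u) bounds the fuel needed, and only the last vertex of the chain is incremented. The cost H of the
first walk is kept separate; it is 200 in the recursive calls. -/
theorem insertRec_spec {ε : ℝ} (hε : Small ε) (fuel : ℕ) {s : State n} {u v : Fin n} {H : ℕ}
    (h : Inv ε s) (he : Exact s) (huv : u ≠ v) (hd : s.deg u ≤ s.deg v)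
    (hH : headWalkLength (level ε (s.deg u)) (s.inB v) ≤ H) :
    (s.deg u < fuel → ∃ s', insertRec ε fuel s u v = some s') ∧
    ∀ s', insertRec ε fuel s u v = some s' → InsertPost ε s u v s' ∧
      (s'.steps : ℝ) ≤ s.steps + H + (220 + 14 * batch ε) * (depth ε (s.deg u) + 1) := by
  induction fuel generalizing s u v H with
  | zero => simp [insertRec]
  | succ fuel ih =>
    have hdr : (s.deg u : ℝ) ≤ slopeBound ε (s.deg v) := by
      have : (s.deg u : ℝ) ≤ s.deg v := by exact_mod_cast hd
      exact le_max_of_le_right (by linarith)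
    have h₁ := h.addArc huv (he u).le hdr
    have hsteps₁ := addArc_steps_le ε s u v
    set s₁ := addArc ε s u v with hs₁
    have hdeg₁ : s₁.deg = s.deg := addArc_deg ε s u v
    have hmult₁ : s₁.mult = set₂ s.mult u v (s.mult u v + 1) := addArc_mult ε s u v
    have hsum₁ : ∀ w, outDegree s₁.mult w = s.deg w + if w = u then 1 else 0 := by
      intro w
      have := outDegree_set₂_add s.mult u v w (s.mult u v + 1)
      rw [← hmult₁, he] at this
      split_ifs at * with hw <;> omega
    obtain ⟨i1, i2, i3, i4, i5, i6⟩ := scan_spec hε u (min (batch ε) (s₁.scanQ u).length) h₁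
      (min_le_right _ _)
    have hrec : insertRec ε (fuel + 1) s u v =
        match scan ε u (min (batch ε) (s₁.scanQ u).length) s₁ with
        | (s₂, some x) => insertRec ε fuel (removeArc ε s₂ u x) x u
        | (s₂, none) => some (setDegree ε s₂ u (s₂.deg u + 1)) := rfl
    rw [hrec]
    have hc : min (batch ε) (s₁.scanQ u).length ≤ batch ε := min_le_left _ _
    generalize hr : scan ε u (min (batch ε) (s₁.scanQ u).length) s₁ = r at *
    obtain ⟨s₂, o⟩ := r
    simp only at i1 i2 i3 i4 i5 i6
    have hdn := depth_nonneg hε (s.deg u)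
    cases o with
    | none =>
      obtain ⟨j1, j2⟩ := i6 rfl
      have hsl := slopeOK_increment hε h₁ i1 i2 i3 j1 j2
      obtain ⟨k1, k2⟩ := i1.setDegree hε (u := u) (d := s₂.deg u + 1) (by omega) le_rfl
        (i1.sum_le u) hsl
      refine ⟨fun _ => ⟨_, rfl⟩, fun s' hs' => ?_⟩
      obtain rfl := Option.some.inj hs'
      refine ⟨⟨k1, fun w => ?_, fun w => ?_, fun a c => ?_⟩, ?_⟩
      · rw [setDegree_mult, setDegree_deg, i3, hsum₁, i2, hdeg₁]
        by_cases hw : w = u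
        · subst hw; simp
        · simp [hw]
      · rw [setDegree_deg, i2, hdeg₁]
        by_cases hw : w = u
        · subst hw; simp
        · simp [hw]
      · rw [setDegree_mult, i3, hmult₁, set₂_succ_add _ huv]
      · have : (setDegree ε s₂ u (s₂.deg u + 1)).steps ≤ s.steps + H + (8 + 14 * batch ε) := by
          omega
        have : ((setDegree ε s₂ u (s₂.deg u + 1)).steps : ℝ) ≤
            s.steps + H + (8 + 14 * batch ε) := by exact_mod_cast this
        have hb : (0 : ℝ) ≤ batch ε := Nat.cast_nonneg _
        nlinarith [mul_nonneg hb hdn]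
    | some x =>
      obtain ⟨hpos, hfl1, hfl2⟩ := i5 x rfl
      rw [hdeg₁] at hfl1 hfl2
      have hpos₂ : 0 < s₂.mult u x := by rw [i3]; exact hpos
      have hne := i1.ne_of_pos hpos₂
      have harc := i1.arc_le hε hpos₂
      have h₃ := i1.removeArc hpos₂
      have hsteps₃ := removeArc_steps_le ε s₂ u x
      have hmult₃ := removeArc_mult ε s₂ u x
      have hdeg₃ : (removeArc ε s₂ u x).deg = s.deg := by rw [removeArc_deg, i2, hdeg₁]
      have he₃ : Exact (removeArc ε s₂ u x) := by
        intro w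
        have := outDegree_set₂_add s₂.mult u x w (s₂.mult u x - 1)
        rw [hmult₃, hdeg₃]
        have h5 := hsum₁ w
        rw [← i3] at h5
        split_ifs at * with hw <;> omega
      have hH₃ : headWalkLength (level ε ((removeArc ε s₂ u x).deg x))
          ((removeArc ε s₂ u x).inB u) ≤ 200 := by
        refine h₃.headWalkLength_le hε ?_
        rwa [removeArc_deg]
      obtain ⟨l1, l2⟩ := ih h₃ he₃ hne.symm (by rw [hdeg₃]; exact hfl2.le) hH₃
      rw [hdeg₃] at l1 l2
      refine ⟨fun hf => l1 (by omega), fun s' hs' => ?_⟩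
      obtain ⟨⟨m1, m2, m3, m4⟩, m5⟩ := l2 s' hs'
      refine ⟨⟨m1, m2, fun w => by rw [← hdeg₃]; exact m3 w, fun a c => ?_⟩, ?_⟩
      · have e1 := m4 a c
        have e2 := set₂_pred_add s₂.mult hne hpos₂ a c
        have e3 := set₂_succ_add s.mult huv a c
        rw [← hmult₁, ← i3] at e3
        rw [← hmult₃] at e2
        rw [pairInd_comm x u] at e1
        omega
      · have hdep : depth ε (s.deg x) + 1 ≤ depth ε (s.deg u) := by
          -- For d(x) ≥ k the lost unit in (1 + ε/2) d(x) < d(u) + 1 is less than ε d(x) / 4.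
          refine depth_add_one_le hε hfl2 fun hb => ?_
          obtain ⟨κ, hκ, hκ1, -⟩ := hε.batch
          have hκx : (κ : ℝ) ≤ s.deg x := by
            have : κ ≤ s.deg x := by omega
            exact_mod_cast this
          have := hε.1
          nlinarith
        have : (removeArc ε s₂ u x).steps ≤ s.steps + H + (13 + 7 * batch ε) := by omega
        have : ((removeArc ε s₂ u x).steps : ℝ) ≤ s.steps + H + (13 + 7 * batch ε) := by
          exact_mod_cast this
        have hb : (0 : ℝ) ≤ batch ε := Nat.cast_nonneg _
        push_cast at m5
        nlinarith


/-! ### Deletion of a copy -/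

theorem Core.firstIn_eq_none {ε : ℝ} {s : State n} (h : Core ε s) {u : Fin n}
    (hf : firstIn s u = none) (w : Fin n) : ¬ 0 < s.mult w u := by
  intro hw
  obtain ⟨B, hB, -, hwB⟩ := ((h.buckets u).mem _ w).2 ⟨hw, rfl⟩
  unfold firstIn at hf
  cases hL : s.inB u with
  | nil => rw [hL] at hB; simp at hB
  | cons C L =>
    have hC : C.2 ≠ [] := (h.buckets u).nonempty C (by rw [hL]; simp)
    rw [hL] at hf
    exact hC (by simpa using hf)

theorem Core.firstIn_eq_some {ε : ℝ} {s : State n} (h : Core ε s) {u x : Fin n}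
    (hf : firstIn s u = some x) : 0 < s.mult x u ∧
      ∀ w, 0 < s.mult w u → level ε (s.per u w) ≤ level ε (s.per u x) := by
  unfold firstIn at hf
  cases hL : s.inB u with
  | nil => rw [hL] at hf; simp at hf
  | cons C L =>
    rw [hL] at hf
    have hx : x ∈ C.2 := List.mem_of_mem_head? (by simpa using hf)
    have hCx := ((h.buckets u).mem C.1 x).1 ⟨C, by rw [hL]; simp, rfl, hx⟩
    refine ⟨hCx.1, fun w hw => ?_⟩
    obtain ⟨B, hB, e, -⟩ := ((h.buckets u).mem _ w).2 ⟨hw, rfl⟩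
    have hs := (h.buckets u).sorted
    rw [hL] at hB hs
    rw [hCx.2, ← e]
    rcases List.mem_cons.1 hB with rfl | hB
    · exact le_rfl
    · exact ((List.pairwise_cons.1 hs).1 B hB).le

/-- One failed test controls all in-neighbours, because none lies in a higher bucket than x. The
losses multiply to (1 + ε/64)(1 + ε/2) / (1 - ε/127) ≤ 1 + 3ε/4. -/
theorem Inv.deg_le_of_not_deletionFlips {ε : ℝ} (hε : Small ε) {s : State n} (h : Inv ε s)
    {u x w : Fin n} (hu : 0 < s.deg u) (hx : ¬ deletionFlips ε s u x) (hw : 0 < s.mult w u)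
    (hl : level ε (s.per u w) ≤ level ε (s.per u x)) :
    (s.deg w : ℝ) ≤ slopeBound ε (s.deg u - 1) := by
  obtain ⟨κ, hκ, hκ1, -⟩ := hε.batch
  obtain ⟨hε0, hε1⟩ := hε
  obtain ⟨d, hd⟩ : ∃ d, s.deg u = d + 1 := ⟨s.deg u - 1, by omega⟩
  obtain ⟨t, h1, h2, h3⟩ := h.info w u hw
  rw [hκ, Nat.add_sub_cancel] at h3
  rw [hd, Nat.add_sub_cancel]
  unfold deletionFlips at hx
  rw [hd] at hx
  push_cast at hx
  rw [add_sub_cancel_right, not_and_or, not_lt, not_lt] at hx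
  set p := s.per u w
  -- Raising 0 to 1 keeps the bucket and permits comparing values by ratio.
  obtain ⟨P, hP⟩ : ∃ P, P = max (s.per u x) 1 := ⟨_, rfl⟩
  have hP0 : 0 < P := by omega
  have hd0 : (0 : ℝ) ≤ d := Nat.cast_nonneg _
  have hPd : (P : ℝ) ≤ (1 + ε / 2) * d ∨ P ≤ d + 1 := by
    rcases le_total (s.per u x) 1 with h0 | h0
    · right; omega
    · rw [hP, max_eq_left h0]; exact hx
  have hpP : (p : ℝ) < (1 + ε / 64) * P :=
    lt_of_level_le hε0 hP0 (hl.trans (level_mono hε0 (by omega)))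
  have hP1 : (1 : ℝ) ≤ P := by exact_mod_cast hP0
  have hdw : (s.deg w : ℝ) ≤ p + t := by exact_mod_cast h1
  have hκt : (κ : ℝ) * t ≤ s.deg w := by
    have : κ * t ≤ s.deg w := by omega
    exact_mod_cast this
  have ht0 : (0 : ℝ) ≤ t := Nat.cast_nonneg _
  have hεt : 127 * (t : ℝ) ≤ ε * s.deg w := by nlinarith
  -- For small d integrality removes the bucket error, and d(w) is too small for any t ≥ 1. For
  -- large d the term d + 1 is below (1 + ε/2) d.
  rcases lt_or_ge (ε * d) 4 with hd4 | hd4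
  · have hPd2 : P ≤ d + 2 := by
      rcases hPd with hPd | hPd
      · have : (P : ℝ) < (d + 2 + 1 : ℕ) := by push_cast; nlinarith
        have := Nat.cast_lt.1 this
        omega
      · omega
    have hPd2' : (P : ℝ) ≤ d + 2 := by exact_mod_cast hPd2
    have hεP : ε * P ≤ 5 := by nlinarith
    have hpP' : p ≤ P := by
      have : (p : ℝ) < (P + 1 : ℕ) := by push_cast; nlinarith
      have := Nat.cast_lt.1 this
      omega
    have ht : t = 0 := by
      by_contra ht
      have ht1 : (1 : ℝ) ≤ t := by exact_mod_cast Nat.pos_of_ne_zero ht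
      have : (p : ℝ) ≤ P := by exact_mod_cast hpP'
      nlinarith
    rw [ht] at hdw
    have hpP'' : (p : ℝ) ≤ P := by exact_mod_cast hpP'
    push_cast at hdw
    unfold slopeBound
    rcases hPd with hPd | hPd
    · refine le_max_of_le_left ?_
      nlinarith
    · refine le_max_of_le_right ?_
      have : (P : ℝ) ≤ d + 1 := by exact_mod_cast hPd
      linarith
  · refine le_max_of_le_left ?_
    have hPd' : (P : ℝ) ≤ (1 + ε / 2) * d := by
      rcases hPd with hPd | hPd
      · exact hPd
      · have : (P : ℝ) ≤ d + 1 := by exact_mod_cast hPd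
        nlinarith
    have e1 : (s.deg w : ℝ) * (1 - ε / 127) ≤ (1 + ε / 64) * ((1 + ε / 2) * d) := by
      have : (1 + ε / 64) * P ≤ (1 + ε / 64) * ((1 + ε / 2) * d) := by gcongr
      nlinarith
    by_contra hc
    push Not at hc
    have e2 : (1 + 3 * ε / 4) * d * (1 - ε / 127) < (s.deg w : ℝ) * (1 - ε / 127) :=
      mul_lt_mul_of_pos_right hc (by linarith)
    nlinarith [mul_nonneg hε0.le hd0, mul_nonneg (mul_nonneg hε0.le hε0.le) hd0]

/-- The outcome of the deletion of a copy of `uv`. -/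
structure DeletePost (ε : ℝ) (s : State n) (u v : Fin n) (s' : State n) : Prop where
  inv : Inv ε s'
  exact : Exact s'
  deg_le : ∀ w, s'.deg w ≤ s.deg w
  mult_add : ∀ a c, s'.mult a c + s'.mult c a + pairInd u v a c = s.mult a c + s.mult c a

/-- For arcs out of u the decrement cancels one counted increment; if t = 0, the position still fits
because the list length is at most d(u) - 1. Arcs into u restart at t = 0 by `hin`, although they
were not scanned. -/
theorem slopeOK_decrement {ε : ℝ} (hε : Small ε) {s : State n} (h : Inv ε s) {u : Fin n}
    (hsum : outDegree s.mult u + 1 = s.deg u)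
    (hin : ∀ w, 0 < s.mult w u → (s.deg w : ℝ) ≤ slopeBound ε (s.deg u - 1)) :
    SlopeOK ε (Function.update s.deg u (s.deg u - 1)) s.mult s.scanQ := by
  intro a x hax
  have hne : x ≠ a := (h.ne_of_pos hax).symm
  have hlen := h.length_scanQ_le a
  have hidx : (s.scanQ a).idxOf x < (s.scanQ a).length :=
    List.idxOf_lt_length_iff.2 ((h.scan_mem _ _).2 hax)
  obtain ⟨t, e1, e2⟩ := h.slope a x hax
  by_cases ha : a = u
  · subst ha
    rw [Function.update_self, Function.update_of_ne hne]
    have hr : ((s.deg a - 1 : ℕ) : ℝ) = s.deg a - 1 := by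
      rw [Nat.cast_sub (by omega), Nat.cast_one]
    cases t with
    | zero =>
      refine ⟨0, ?_, by omega⟩
      rw [hr]
      linarith
    | succ t =>
      refine ⟨t, ?_, ?_⟩
      · rw [hr]
        push_cast at e1
        linarith
      · obtain ⟨κ, hκ, hκ1, -⟩ := hε.batch
        have hκ0 : 0 < κ := by
          rcases Nat.eq_zero_or_pos κ with rfl | h0
          · norm_num at hκ1
          · exact h0
        rw [mul_add, mul_one] at e2
        omega
  · rw [Function.update_of_ne ha]
    by_cases hx : x = u
    · subst hx
      rw [Function.update_self]
      refine ⟨0, by simpa using hin a hax, ?_⟩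
      have := h.sum_le a
      omega
    · rw [Function.update_of_ne hx]
      exact ⟨t, e1, e2⟩

/-- The test sees only perceived degrees, but progress has to be in true ones. If the perceived
value is not exact, both degrees are of order at least 1/ε, and the gap between 1 + ε/2 and 1 + ε/4
absorbs the error and the subtracted unit. -/
theorem Inv.deg_of_deletionFlips {ε : ℝ} (hε : Small ε) {s : State n} (h : Inv ε s)
    {u x : Fin n} (hxu : 0 < s.mult x u) (hx : deletionFlips ε s u x) :
    s.deg u + 1 ≤ s.deg x ∧ (batch ε ≤ s.deg u → (1 + ε / 4) * s.deg u ≤ (s.deg x : ℝ)) := by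
  obtain ⟨hx1, hx2⟩ := hx
  have harc := h.arc_le hε hxu
  obtain ⟨κ, hκ, hκ1, -⟩ := hε.batch
  obtain ⟨hε0, hε1⟩ := hε
  obtain ⟨t, h1, h2, h3⟩ := h.info x u hxu
  rw [hκ, Nat.add_sub_cancel] at h3
  have hu0 : (0 : ℝ) ≤ s.deg u := Nat.cast_nonneg _
  rcases Nat.eq_zero_or_pos t with rfl | ht
  · have hp : s.per u x = s.deg x := by omega
    rw [hp] at hx1 hx2
    refine ⟨hx2, fun hk => ?_⟩
    have : (κ : ℝ) ≤ s.deg u := by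
      have : κ ≤ s.deg u := by omega
      exact_mod_cast this
    nlinarith
  · have ht' : (1 : ℝ) ≤ t := by exact_mod_cast ht
    have hκt : (κ : ℝ) * t ≤ s.deg x := by
      have : κ * t ≤ s.deg x := by omega
      exact_mod_cast this
    have hεt : 127 * (t : ℝ) ≤ ε * s.deg x := by nlinarith
    have hp : (s.per u x : ℝ) ≤ s.deg x + t := by exact_mod_cast h2
    have hεx : 127 ≤ ε * (s.deg x : ℝ) := by linarith
    have hεu : 120 ≤ ε * (s.deg u : ℝ) := by
      by_contra hc
      push Not at hc
      rcases le_max_iff.1 harc with e | e <;> nlinarith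
    have key : (1 + ε / 4) * s.deg u ≤ (s.deg x : ℝ) := by
      by_contra hc
      push Not at hc
      have e1 : (1 + ε / 2) * ((s.deg u : ℝ) - 1) < s.deg x * (1 + ε / 127) := by linarith
      have e2 : (s.deg x : ℝ) * (1 + ε / 127) < (1 + ε / 4) * s.deg u * (1 + ε / 127) :=
        mul_lt_mul_of_pos_right hc (by linarith)
      nlinarith [mul_nonneg hε0.le hu0, mul_nonneg (mul_nonneg hε0.le hε0.le) hu0]
    refine ⟨?_, fun _ => key⟩
    have : (s.deg u : ℝ) + 1 ≤ s.deg x := by linarith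
    exact_mod_cast this

open Classical in
-- Here the chain climbs. Its length is measured by the remaining depth up to a common bound M,
-- which stays valid because deletions never raise a degree.
theorem deleteRec_spec {ε : ℝ} (hε : Small ε) (fuel : ℕ) {s : State n} {u v : Fin n} {M : ℕ}
    (h : Inv ε s) (he : Exact s) (huv : 0 < s.mult u v) (hM : ∀ w, s.deg w ≤ M) :
    (M < s.deg u + fuel → ∃ s', deleteRec ε fuel s u v = some s') ∧
    ∀ s', deleteRec ε fuel s u v = some s' → DeletePost ε s u v s' ∧
      (s'.steps : ℝ) ≤ s.steps +
        (220 + 14 * batch ε) * (depth ε M - depth ε (s.deg u) + 1) := by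
  induction fuel generalizing s u v with
  | zero => simpa [deleteRec] using hM u
  | succ fuel ih =>
    have hne := h.ne_of_pos huv
    have h₁ := (h.removeArc huv).tick 1
    have hsteps₁ : ((removeArc ε s u v).tick 1).steps ≤ s.steps + 7 := by
      have := removeArc_steps_le ε s u v
      simp only [State.tick]
      omega
    have hdeg₁ : ((removeArc ε s u v).tick 1).deg = s.deg := removeArc_deg ε s u v
    have hmult₁ : ((removeArc ε s u v).tick 1).mult = set₂ s.mult u v (s.mult u v - 1) :=
      removeArc_mult ε s u v
    have hrec : deleteRec ε (fuel + 1) s u v =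
        match firstIn ((removeArc ε s u v).tick 1) u with
        | some x =>
          if deletionFlips ε ((removeArc ε s u v).tick 1) u x then
            deleteRec ε fuel (addArc ε ((removeArc ε s u v).tick 1) u x) x u
          else some (setDegree ε ((removeArc ε s u v).tick 1) u
            (((removeArc ε s u v).tick 1).deg u - 1))
        | none => some (setDegree ε ((removeArc ε s u v).tick 1) u
            (((removeArc ε s u v).tick 1).deg u - 1)) := rfl
    rw [hrec]
    generalize (removeArc ε s u v).tick 1 = s₁ at *
    have hsum₁ : ∀ w, outDegree s₁.mult w + (if w = u then 1 else 0) = s.deg w := by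
      intro w
      have := outDegree_set₂_add s.mult u v w (s.mult u v - 1)
      rw [← hmult₁, he] at this
      split_ifs at * with hw <;> omega
    have hsumu : outDegree s₁.mult u + 1 = s₁.deg u := by simpa [hdeg₁] using hsum₁ u
    have hb : (0 : ℝ) ≤ batch ε := Nat.cast_nonneg _
    have hdM := depth_mono hε (hM u)
    -- Shared by the two ways to stop: no in-neighbour is left, or the test fails.
    have terminal : (∀ w, 0 < s₁.mult w u → (s₁.deg w : ℝ) ≤ slopeBound ε (s₁.deg u - 1)) →
        DeletePost ε s u v (setDegree ε s₁ u (s₁.deg u - 1)) ∧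
        ((setDegree ε s₁ u (s₁.deg u - 1)).steps : ℝ) ≤ s.steps +
          (220 + 14 * batch ε) * (depth ε M - depth ε (s.deg u) + 1) := by
      intro hin
      obtain ⟨k1, k2⟩ := h₁.setDegree hε (u := u) (d := s₁.deg u - 1) (by omega) (by omega)
        (by omega) (slopeOK_decrement hε h₁ hsumu hin)
      refine ⟨⟨k1, fun w => ?_, fun w => ?_, fun a c => ?_⟩, ?_⟩
      · have := hsum₁ w
        rw [setDegree_mult, setDegree_deg]
        by_cases hw : w = u
        · subst hw
          rw [Function.update_self]
          omega
        · rw [Function.update_of_ne hw, hdeg₁]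
          simpa [hw] using this
      · rw [setDegree_deg, hdeg₁]
        by_cases hw : w = u
        · subst hw; simp
        · simp [hw]
      · rw [setDegree_mult, hmult₁, set₂_pred_add _ hne huv]
      · have : (setDegree ε s₁ u (s₁.deg u - 1)).steps ≤ s.steps + (8 + 7 * batch ε) := by
          omega
        have : ((setDegree ε s₁ u (s₁.deg u - 1)).steps : ℝ) ≤
            s.steps + (8 + 7 * batch ε) := by exact_mod_cast this
        have := mul_nonneg hb (sub_nonneg.2 hdM)
        nlinarith
    cases hf : firstIn s₁ u with
    | none =>
      refine ⟨fun _ => ⟨_, rfl⟩, fun s' hs' => ?_⟩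
      obtain rfl := Option.some.inj hs'
      exact terminal fun w hw => absurd hw (h₁.firstIn_eq_none hf w)
    | some x =>
      obtain ⟨hxu, hmax⟩ := h₁.firstIn_eq_some hf
      by_cases hfl : deletionFlips ε s₁ u x
      · simp only [if_pos hfl]
        obtain ⟨hd1, hd2⟩ := h₁.deg_of_deletionFlips hε hxu hfl
        have hnex := (h₁.ne_of_pos hxu).symm
        have harc := h₁.arc_le hε hxu
        have hslope : (s₁.deg u : ℝ) ≤ slopeBound ε (s₁.deg x) := by
          have : (s₁.deg u : ℝ) + 1 ≤ s₁.deg x := by exact_mod_cast hd1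
          exact le_max_of_le_right (by linarith)
        have h₂ := h₁.addArc hnex (by omega) hslope
        have hH := h₁.headWalkLength_le hε harc
        have hsteps₂ := addArc_steps_le ε s₁ u x
        have hdeg₂ : (addArc ε s₁ u x).deg = s.deg := by rw [addArc_deg, hdeg₁]
        have hmult₂ := addArc_mult ε s₁ u x
        have he₂ : Exact (addArc ε s₁ u x) := by
          intro w
          have := outDegree_set₂_add s₁.mult u x w (s₁.mult u x + 1)
          rw [hmult₂, hdeg₂]
          have h5 := hsum₁ w
          split_ifs at * with hw <;> omega
        have hpos₂ : 0 < (addArc ε s₁ u x).mult x u := by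
          rw [addArc_mult_pos]; exact Or.inl hxu
        obtain ⟨l1, l2⟩ := ih h₂ he₂ hpos₂ (by rw [hdeg₂]; exact hM)
        rw [hdeg₂] at l1 l2
        rw [hdeg₁] at hd1 hd2
        refine ⟨fun hfu => l1 (by omega), fun s' hs' => ?_⟩
        obtain ⟨⟨m1, m2, m3, m4⟩, m5⟩ := l2 s' hs'
        refine ⟨⟨m1, m2, fun w => by rw [← hdeg₂]; exact m3 w, fun a c => ?_⟩, ?_⟩
        · have e1 := m4 a c
          have e2 := set₂_pred_add s.mult hne huv a c
          have e3 := set₂_succ_add s₁.mult hnex a c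
          rw [← hmult₁] at e2
          rw [← hmult₂] at e3
          rw [pairInd_comm x u] at e1
          omega
        · have hdep := depth_add_one_le hε hd1 hd2
          have : (addArc ε s₁ u x).steps ≤ s.steps + 214 := by omega
          have : ((addArc ε s₁ u x).steps : ℝ) ≤ s.steps + 214 := by exact_mod_cast this
          have := mul_le_mul_of_nonneg_left hdep (by positivity : (0 : ℝ) ≤ 220 + 14 * batch ε)
          linarith
      · simp only [if_neg hfl]
        refine ⟨fun _ => ⟨_, rfl⟩, fun s' hs' => ?_⟩
        obtain rfl := Option.some.inj hs'
        exact terminal fun w hw =>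
          h₁.deg_le_of_not_deletionFlips hε (by omega) hfl hw (hmax w hw)

/-! ### The procedures without a bound on the depth -/

/-- Since Q is known for every successful cut-off depth, no comparison between depths is needed. -/
theorem exists_unbounded_eq {f : ℕ → Option (State n)} {Q : State n → Prop}
    (h : ∃ fuel s', f fuel = some s') (hQ : ∀ fuel s', f fuel = some s' → Q s') :
    ∃ s', unbounded f = some s' ∧ Q s' := by
  have h' : ∃ fuel, (f fuel).isSome := by
    obtain ⟨fuel, s', e⟩ := h
    exact ⟨fuel, by rw [e]; rfl⟩
  unfold unbounded
  rw [dif_pos h']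
  classical
  obtain ⟨s', e⟩ := Option.isSome_iff_exists.1 (Nat.find_spec h')
  refine ⟨s', ?_, hQ _ _ e⟩
  convert e

theorem insertArc_spec {ε : ℝ} (hε : Small ε) {s : State n} {u v : Fin n} {H : ℕ}
    (h : Inv ε s) (he : Exact s) (huv : u ≠ v) (hd : s.deg u ≤ s.deg v)
    (hH : headWalkLength (level ε (s.deg u)) (s.inB v) ≤ H) :
    ∃ s', insertArc ε s u v = some s' ∧ InsertPost ε s u v s' ∧
      (s'.steps : ℝ) ≤ s.steps + H + (220 + 14 * batch ε) * (depth ε (s.deg u) + 1) :=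
  exists_unbounded_eq ⟨s.deg u + 1, (insertRec_spec hε _ h he huv hd hH).1 (Nat.lt_succ_self _)⟩
    fun fuel => (insertRec_spec hε fuel h he huv hd hH).2

theorem deleteArc_spec {ε : ℝ} (hε : Small ε) {s : State n} {u v : Fin n} {M : ℕ}
    (h : Inv ε s) (he : Exact s) (huv : 0 < s.mult u v) (hM : ∀ w, s.deg w ≤ M) :
    ∃ s', deleteArc ε s u v = some s' ∧ DeletePost ε s u v s' ∧
      (s'.steps : ℝ) ≤ s.steps +
        (220 + 14 * batch ε) * (depth ε M - depth ε (s.deg u) + 1) :=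
  exists_unbounded_eq ⟨M + 1, (deleteRec_spec hε _ h he huv hM).1 (by omega)⟩
    fun fuel => (deleteRec_spec hε fuel h he huv hM).2

/-! ### Updates of edges -/

/-- A bound for the time of the insertion or deletion of one copy, if the out-degrees are at
most `M`. -/
noncomputable def arcTime (ε : ℝ) (M : ℕ) : ℝ :=
  2 + level ε (2 * M) + (220 + 14 * batch ε) * (depth ε M + 1)

/-- The crude bound for the outermost call, whose ends need not be adjacent: t ≤ κ t ≤ d(w) makes
perceived values at most 2M. -/
theorem Inv.headWalkLength_le_of_deg_le {ε : ℝ} (hε : Small ε) {s : State n} (h : Inv ε s)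
    {M : ℕ} (hM : ∀ w, s.deg w ≤ M) (u v : Fin n) :
    headWalkLength (level ε (s.deg u)) (s.inB v) ≤ level ε (2 * M) + 1 := by
  have hu := hM u
  refine (((h.buckets v).headWalkLength_le hε.1 (p := s.deg u) (q := 2 * M) (by omega)
    fun w hw => ?_).2).trans (by omega)
  obtain ⟨κ, hκ, hκ1, -⟩ := hε.batch
  have hκ0 : 0 < κ := by
    rcases Nat.eq_zero_or_pos κ with rfl | h0
    · norm_num at hκ1
    · exact h0
  obtain ⟨t, -, h2, h3⟩ := h.info w v hw
  rw [hκ, Nat.add_sub_cancel] at h3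
  have := hM w
  nlinarith

theorem repeatRun_spec {P : ℕ → State n → Prop} {f : State n → Option (State n)} {T : ℝ}
    (hf : ∀ c s, P (c + 1) s → ∃ s', f s = some s' ∧ P c s' ∧ (s'.steps : ℝ) ≤ s.steps + T)
    (c : ℕ) {s : State n} (hs : P c s) :
    ∃ s', repeatRun f c s = some s' ∧ P 0 s' ∧ (s'.steps : ℝ) ≤ s.steps + c * T := by
  induction c generalizing s with
  | zero => exact ⟨s, rfl, hs, by simp⟩
  | succ c ih =>
    obtain ⟨s₁, e₁, h₁, t₁⟩ := hf c s hs
    obtain ⟨s₂, e₂, h₂, t₂⟩ := ih h₁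
    refine ⟨s₂, ?_, h₂, ?_⟩
    · rw [repeatRun, e₁]; exact e₂
    · push_cast; linarith

theorem insertEdge_spec {η : ℝ} {b : ℕ} (hε : Small (η / b)) {s : State n} {u v : Fin n} {M : ℕ}
    (h : Inv (η / b) s) (he : Exact s) (huv : u ≠ v) (hM : ∀ w, s.deg w + b ≤ M) :
    ∃ s', insertEdge η b s u v = some s' ∧ (Inv (η / b) s' ∧ Exact s' ∧
      ∀ a c, s'.mult a c + s'.mult c a = s.mult a c + s.mult c a + b * pairInd u v a c) ∧
      (s'.steps : ℝ) ≤ s.steps + b * arcTime (η / b) M := by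
  refine Exists.imp (fun s' ⟨e, ⟨i1, i2, _, i4⟩, i5⟩ =>
    ⟨e, ⟨i1, i2, fun a c => by simpa using i4 a c⟩, i5⟩) (repeatRun_spec (T := arcTime (η / b) M)
    -- The counter c is the number of copies still to be inserted; each may raise a degree by one,
    -- hence the bound d(w) + c ≤ M.
    (P := fun c t => Inv (η / b) t ∧ Exact t ∧ (∀ w, t.deg w + c ≤ M) ∧
      ∀ x y, t.mult x y + t.mult y x + c * pairInd u v x y =
        s.mult x y + s.mult y x + b * pairInd u v x y)
    (f := fun t => if t.deg u ≤ t.deg v then insertArc (η / b) (t.tick 1) u v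
      else insertArc (η / b) (t.tick 1) v u) ?_ b
    (s := s) ⟨h, he, hM, fun x y => rfl⟩)
  rintro c t ⟨h1, h2, h3, h4⟩
  have main : ∀ x y, x ≠ y → t.deg x ≤ t.deg y → (∀ a c, pairInd x y a c = pairInd u v a c) →
      ∃ s', insertArc (η / b) (t.tick 1) x y = some s' ∧ (Inv (η / b) s' ∧ Exact s' ∧
        (∀ w, s'.deg w + c ≤ M) ∧ ∀ a d, s'.mult a d + s'.mult d a + c * pairInd u v a d =
        s.mult a d + s.mult d a + b * pairInd u v a d) ∧
        (s'.steps : ℝ) ≤ t.steps + arcTime (η / b) M := by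
    intro x y hxy hd hp
    obtain ⟨s', e, ⟨p1, p2, p3, p4⟩, p5⟩ := insertArc_spec hε (h1.tick 1) h2 hxy hd
      ((h1.tick 1).headWalkLength_le_of_deg_le hε (M := M)
        (fun w => le_trans (Nat.le_add_right _ _) (h3 w)) x y)
    refine ⟨s', e, ⟨p1, p2, fun w => ?_, fun a d => ?_⟩, p5.trans ?_⟩
    · have e1 : s'.deg w ≤ t.deg w + 1 := p3 w
      have := h3 w
      omega
    · have e1 : s'.mult a d + s'.mult d a = t.mult a d + t.mult d a + pairInd x y a d := p4 a d
      have e2 := h4 a d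
      rw [hp] at e1
      linarith
    · have hdM : t.deg x ≤ M := le_trans (Nat.le_add_right _ _) (h3 x)
      have := mul_le_mul_of_nonneg_left (depth_mono hε hdM)
        (by positivity : (0 : ℝ) ≤ 220 + 14 * batch (η / b))
      unfold arcTime
      simp only [State.tick]
      push_cast
      linarith
  by_cases hd : t.deg u ≤ t.deg v
  · simp only [if_pos hd]
    exact main u v huv hd fun _ _ => rfl
  · simp only [if_neg hd]
    exact main v u huv.symm (not_le.1 hd).le fun a c => pairInd_comm v u a c

theorem deleteEdge_spec {η : ℝ} {b : ℕ} (hε : Small (η / b)) {s : State n} {u v : Fin n} {M : ℕ}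
    (h : Inv (η / b) s) (he : Exact s) (hb : s.mult u v + s.mult v u = b)
    (hM : ∀ w, s.deg w ≤ M) :
    ∃ s', deleteEdge η b s u v = some s' ∧ (Inv (η / b) s' ∧ Exact s' ∧
      ∀ a c, s'.mult a c + s'.mult c a + b * pairInd u v a c = s.mult a c + s.mult c a) ∧
      (s'.steps : ℝ) ≤ s.steps + b * arcTime (η / b) M := by
  refine Exists.imp (fun s' ⟨e, ⟨i1, i2, _, i4⟩, i5⟩ =>
    ⟨e, ⟨i1, i2, fun a c => by simpa using i4 a c⟩, i5⟩) (repeatRun_spec (T := arcTime (η / b) M)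
    (P := fun c t => Inv (η / b) t ∧ Exact t ∧ (∀ w, t.deg w ≤ M) ∧
      ∀ x y, t.mult x y + t.mult y x + b * pairInd u v x y =
        s.mult x y + s.mult y x + c * pairInd u v x y)
    (f := fun t => if 0 < t.mult u v then deleteArc (η / b) (t.tick 1) u v
      else deleteArc (η / b) (t.tick 1) v u) ?_ b
    (s := s) ⟨h, he, hM, fun x y => rfl⟩)
  rintro c t ⟨h1, h2, h3, h4⟩
  have main : ∀ x y, 0 < t.mult x y → (∀ a c, pairInd x y a c = pairInd u v a c) →
      ∃ s', deleteArc (η / b) (t.tick 1) x y = some s' ∧ (Inv (η / b) s' ∧ Exact s' ∧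
        (∀ w, s'.deg w ≤ M) ∧ ∀ a d, s'.mult a d + s'.mult d a + b * pairInd u v a d =
        s.mult a d + s.mult d a + c * pairInd u v a d) ∧
        (s'.steps : ℝ) ≤ t.steps + arcTime (η / b) M := by
    intro x y hxy hp
    obtain ⟨s', e, ⟨p1, p2, p3, p4⟩, p5⟩ := deleteArc_spec hε (h1.tick 1) h2 hxy h3
    refine ⟨s', e, ⟨p1, p2, fun w => (p3 w).trans (h3 w), fun a d => ?_⟩, p5.trans ?_⟩
    · have e1 : s'.mult a d + s'.mult d a + pairInd x y a d = t.mult a d + t.mult d a := p4 a d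
      have e2 := h4 a d
      rw [hp] at e1
      linarith
    · have := mul_nonneg (by positivity : (0 : ℝ) ≤ 220 + 14 * batch (η / b))
        (depth_nonneg hε ((t.tick 1).deg x))
      have hl : (0 : ℝ) ≤ level (η / b) (2 * M) := Nat.cast_nonneg _
      unfold arcTime
      have hst : ((t.tick 1).steps : ℝ) = t.steps + 1 := by simp [State.tick]
      rw [hst]
      linarith
  by_cases hd : 0 < t.mult u v
  · simp only [if_pos hd]
    exact main u v hd fun _ _ => rfl
  · simp only [if_neg hd]
    refine main v u ?_ fun a c => pairInd_comm v u a c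
    -- Exactly c + 1 copies remain, so if none points from u to v, one points from v to u.
    have e := h4 u v
    have hp : pairInd u v u v = 1 := by simp [pairInd]
    rw [hp] at e
    omega


/-! ### Density -/

theorem maxDensity_nonneg (G : SimpleGraph (Fin n)) : 0 ≤ maxDensity G :=
  Real.iSup_nonneg fun _ => by positivity

theorem ncard_edgeSet_induce_le (G : SimpleGraph (Fin n)) (S : Finset (Fin n)) :
    ((G.induce (S : Set (Fin n))).edgeSet.ncard : ℝ) ≤ maxDensity G * S.card := by
  rcases S.eq_empty_or_nonempty with rfl | hS
  · have : IsEmpty ((∅ : Finset (Fin n)) : Set (Fin n)) := by simp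
    have he : (G.induce (((∅ : Finset (Fin n)) : Set (Fin n)))).edgeSet = ∅ := by
      rw [SimpleGraph.edgeSet_eq_empty]
      exact Subsingleton.elim _ _
    rw [he]
    simp
  · have hc : (0 : ℝ) < S.card := by exact_mod_cast hS.card_pos
    rw [← div_le_iff₀ hc]
    exact le_ciSup (f := fun S : Finset (Fin n) =>
      ((G.induce (S : Set (Fin n))).edgeSet.ncard : ℝ) / (S.card : ℝ))
      (Set.finite_range _).bddAbove S

open Classical in
theorem sum_adj_eq (G : SimpleGraph (Fin n)) (S : Finset (Fin n)) :
    ∑ u ∈ S, ∑ v ∈ S, (if G.Adj u v then 1 else 0) =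
      2 * (G.induce (S : Set (Fin n))).edgeSet.ncard := by
  rw [Set.ncard_eq_toFinset_card', ← SimpleGraph.edgeFinset,
    ← SimpleGraph.sum_degrees_eq_twice_card_edges]
  rw [Finset.sum_subtype S (p := fun x => x ∈ (S : Set (Fin n))) (by simp)]
  refine Finset.sum_congr rfl fun u _ => ?_
  rw [Finset.sum_subtype S (p := fun x => x ∈ (S : Set (Fin n))) (by simp),
    ← SimpleGraph.card_neighborFinset_eq_degree, SimpleGraph.neighborFinset_eq_filter,
    Finset.card_filter]
  rfl

theorem sum_mult_le {b : ℕ} {G : SimpleGraph (Fin n)} {m : Fin n → Fin n → ℕ}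
    (h : IsOrientationOfCopies b G m) (S : Finset (Fin n)) :
    ((∑ u ∈ S, ∑ v ∈ S, m u v : ℕ) : ℝ) ≤ b * (maxDensity G * S.card) := by
  classical
  have h1 : 2 * ∑ u ∈ S, ∑ v ∈ S, m u v = b * (2 * (G.induce (S : Set (Fin n))).edgeSet.ncard) := by
    rw [← sum_adj_eq, two_mul]
    nth_rewrite 2 [Finset.sum_comm]
    rw [← Finset.sum_add_distrib, Finset.mul_sum]
    refine Finset.sum_congr rfl fun u _ => ?_
    rw [← Finset.sum_add_distrib, Finset.mul_sum]
    refine Finset.sum_congr rfl fun v _ => ?_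
    rw [h u v]
    split_ifs <;> simp
  have h2 : ∑ u ∈ S, ∑ v ∈ S, m u v = b * (G.induce (S : Set (Fin n))).edgeSet.ncard := by
    linarith
  rw [h2]
  push_cast
  exact mul_le_mul_of_nonneg_left (ncard_edgeSet_induce_le G S) (Nat.cast_nonneg _)

/-- All arcs leaving T i end in T (i + 1), so |T i| · D/2 counts arcs inside T (i + 1), of which
there are at most bρ |T (i + 1)|. With D > 4bρ the size doubles until it exceeds n. -/
theorem outDegree_le_of_slope {b : ℕ} {G : SimpleGraph (Fin n)} {m : Fin n → Fin n → ℕ} {ε : ℝ}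
    (hε : 0 ≤ ε) (hn : (1 + ε) ^ (Nat.log 2 n + 1) ≤ 2) (h : IsOrientationOfCopies b G m)
    (hs : ∀ u v, 0 < m u v → (outDegree m u : ℝ) ≤ (1 + ε) * outDegree m v) (u : Fin n) :
    (outDegree m u : ℝ) ≤ 4 * (b * maxDensity G) := by
  by_contra hc
  push Not at hc
  have hρ := maxDensity_nonneg G
  have hb : (0 : ℝ) ≤ b := Nat.cast_nonneg _
  obtain ⟨D, hD⟩ : ∃ D : ℝ, D = outDegree m u := ⟨_, rfl⟩
  rw [← hD] at hc
  have hD0 : 0 < D := lt_of_le_of_lt (by positivity) hc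
  set T : ℕ → Finset (Fin n) := fun i => univ.filter fun v => D ≤ (1 + ε) ^ i * outDegree m v
    with hT
  have memT : ∀ i v, v ∈ T i ↔ D ≤ (1 + ε) ^ i * outDegree m v := fun i v => by simp [hT]
  have key : ∀ i ≤ Nat.log 2 n + 1, 2 ^ i ≤ (T i).card := by
    intro i
    induction i with
    | zero =>
      intro _
      exact Finset.card_pos.2 ⟨u, (memT 0 u).2 (by simp [hD])⟩
    | succ i ih =>
      intro hi
      have hcard := ih (by omega)
      have hsub : T i ⊆ T (i + 1) := by
        intro v hv
        rw [memT] at hv ⊢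
        refine hv.trans ?_
        gcongr
        · linarith
        · omega
      have hpow : (1 + ε) ^ i ≤ 2 := (pow_le_pow_right₀ (by linarith) (by omega)).trans hn
      have h1 : ((T i).card : ℝ) * (D / 2) ≤ ((∑ a ∈ T i, outDegree m a : ℕ) : ℝ) := by
        rw [Nat.cast_sum, ← nsmul_eq_mul]
        refine Finset.card_nsmul_le_sum _ _ _ fun a ha => ?_
        rw [memT] at ha
        have : (0 : ℝ) ≤ outDegree m a := Nat.cast_nonneg _
        nlinarith
      have h2 : ∑ a ∈ T i, outDegree m a ≤ ∑ a ∈ T (i + 1), ∑ v ∈ T (i + 1), m a v := by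
        refine le_trans (Finset.sum_le_sum fun a ha => ?_)
          (Finset.sum_le_sum_of_subset (f := fun a => ∑ v ∈ T (i + 1), m a v) hsub)
        refine (Finset.sum_subset (Finset.subset_univ _) fun v _ hv => ?_).ge
        by_contra hav
        refine hv ((memT _ _).2 (((memT _ _).1 ha).trans ?_))
        rw [pow_succ, mul_assoc]
        have := hs a v (Nat.pos_of_ne_zero hav)
        gcongr
      have h3 : ((∑ a ∈ T i, outDegree m a : ℕ) : ℝ) ≤
          ((∑ a ∈ T (i + 1), ∑ v ∈ T (i + 1), m a v : ℕ) : ℝ) := by exact_mod_cast h2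
      have h4 := sum_mult_le h (T (i + 1))
      have h5 : b * (maxDensity G * (T (i + 1)).card) ≤ D / 4 * (T (i + 1)).card := by
        rw [← mul_assoc]
        gcongr
        linarith
      have h6 : ((T i).card : ℝ) * 2 ≤ (T (i + 1)).card := by
        have : ((T i).card : ℝ) * 2 * (D / 4) ≤ (T (i + 1)).card * (D / 4) := by linarith
        exact le_of_mul_le_mul_right this (by positivity)
      have h7 : (T i).card * 2 ≤ (T (i + 1)).card := by exact_mod_cast h6
      rw [pow_succ]
      omega
  have h1 := key _ le_rfl
  have h2 : (T (Nat.log 2 n + 1)).card ≤ n := (Finset.card_le_univ _).trans (by simp)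
  have h3 := Nat.lt_pow_succ_log_self (b := 2) (by norm_num) n
  rw [Nat.succ_eq_add_one] at h3
  omega

/-! ### Admissible parameters -/

theorem Admissible.small {γ η : ℝ} {n b : ℕ} (h : Admissible γ η n b) : Small (η / b) := by
  obtain ⟨hn, hb, hη, hle⟩ := h
  have hb' : (0 : ℝ) < b := by exact_mod_cast hb
  refine ⟨by positivity, ?_⟩
  rw [div_eq_mul_inv]
  refine hle.trans ?_
  have h2 : Real.log 2 ≤ Real.log n := Real.log_le_log (by norm_num) (by exact_mod_cast hn)
  have h3 := Real.log_two_gt_d9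
  have h4 : (1 : ℝ) ≤ max γ⁻¹ 1 := le_max_right _ _
  -- The number 69 is 100 log 2 rounded down, the worst case being n = 2.
  refine one_div_le_one_div_of_le (by norm_num) ?_
  nlinarith

theorem Admissible.pow_le {γ η : ℝ} {n b : ℕ} (h : Admissible γ η n b) :
    (1 + η / b) ^ (Nat.log 2 n + 1) ≤ 2 := by
  obtain ⟨hε0, hε1⟩ := h.small
  obtain ⟨hn, hb, hη, hle⟩ := h
  have hn' : (2 : ℝ) ≤ n := by exact_mod_cast hn
  have hl2 := Real.log_two_gt_d9
  have h2 : Real.log 2 ≤ Real.log n := Real.log_le_log (by norm_num) hn'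
  have h4 : (1 : ℝ) ≤ max γ⁻¹ 1 := le_max_right _ _
  have hlogn : 0 < Real.log n := by linarith
  have hlog : (Nat.log 2 n : ℝ) * Real.log 2 ≤ Real.log n := by
    rw [← Real.log_pow]
    refine Real.log_le_log (by positivity) ?_
    exact_mod_cast Nat.pow_log_le_self 2 (by omega)
  have hε : η / b * (100 * Real.log n) ≤ 1 := by
    rw [div_eq_mul_inv]
    rw [le_div_iff₀ (by positivity)] at hle
    have : 0 < η * (b : ℝ)⁻¹ := by rw [← div_eq_mul_inv]; exact hε0
    have : η * (b : ℝ)⁻¹ * (100 * Real.log n) ≤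
        η * (b : ℝ)⁻¹ * (100 * Real.log n * max γ⁻¹ 1) := by
      exact mul_le_mul_of_nonneg_left (le_mul_of_one_le_right (by positivity) h4) this.le
    linarith
  have hexp : (1 + η / b) ^ (Nat.log 2 n + 1) ≤ Real.exp ((Nat.log 2 n + 1 : ℕ) * (η / b)) := by
    rw [Real.exp_nat_mul]
    gcongr
    linarith [Real.add_one_le_exp (η / b)]
  refine hexp.trans ?_
  rw [← Real.le_log_iff_exp_le (by norm_num)]
  push_cast
  have h5 : ((Nat.log 2 n : ℝ) + 1) * Real.log 2 ≤ 2 * Real.log n := by linarith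
  -- The exponent is at most 2 log n / log 2, and ε log n ≤ 1/100.
  have h6 : ((Nat.log 2 n : ℝ) + 1) * (η / b) * Real.log 2 ≤ 1 / 50 := by nlinarith
  nlinarith [mul_nonneg (by positivity : (0 : ℝ) ≤ (Nat.log 2 n : ℝ) + 1) hε0.le]

theorem Admissible.le_b {γ η : ℝ} {n b : ℕ} (h : Admissible γ η n b) : 69 * η ≤ b := by
  obtain ⟨hε0, hε1⟩ := h.small
  have hb' : (0 : ℝ) < b := by exact_mod_cast h.2.1
  rw [div_le_iff₀ hb'] at hε1
  linarith

theorem exists_admissible {γ η : ℝ} (hη : 1280 < η) :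
    ∃ K : ℝ, ∀ n : ℕ, 2 ≤ n → ∃ b : ℕ, Admissible γ η n b ∧ (b : ℝ) ≤ K * Real.log n := by
  have hm : (1 : ℝ) ≤ max γ⁻¹ 1 := le_max_right _ _
  -- The summand 2 pays for rounding up, since 2 log n ≥ 2 log 2 > 1.
  refine ⟨100 * η * max γ⁻¹ 1 + 2, fun n hn => ?_⟩
  have h2 : Real.log 2 ≤ Real.log n := Real.log_le_log (by norm_num) (by exact_mod_cast hn)
  have h3 := Real.log_two_gt_d9
  have hl : 0 < Real.log n := by linarith
  have hX : 0 < η * (100 * Real.log n * max γ⁻¹ 1) := by positivity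
  have hb := Nat.ceil_pos.2 hX
  have hbr : (0 : ℝ) < ⌈η * (100 * Real.log n * max γ⁻¹ 1)⌉₊ := by exact_mod_cast hb
  refine ⟨⌈η * (100 * Real.log n * max γ⁻¹ 1)⌉₊, ⟨hn, hb, hη, ?_⟩, ?_⟩
  · rw [← div_eq_mul_inv, div_le_div_iff₀ hbr (by positivity), one_mul]
    exact Nat.le_ceil _
  · have := Nat.ceil_lt_add_one hX.le
    nlinarith

/-! ### Reachable states -/

theorem Reachable.spec {γ η : ℝ} {b : ℕ} (hadm : Admissible γ η n b) {G : SimpleGraph (Fin n)}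
    {s : State n} (h : Reachable η b G s) :
    Inv (η / b) s ∧ Exact s ∧ IsOrientationOfCopies b G s.mult := by
  classical
  have hε := hadm.small
  induction h with
  | empty =>
    refine ⟨⟨⟨fun _ => rfl, ?_, ?_, ?_, ?_, ?_, ?_⟩, ?_, ?_, ?_⟩, ?_, ?_⟩
    · simp [State.empty, wins]
    · simp [State.empty]
    · simp [State.empty]
    · simp [State.empty]
    · simp [State.empty]
    · intro v
      exact ⟨by simp [State.empty], by simp [State.empty], by simp [State.empty],
        by simp [State.empty]⟩
    · simp [State.empty, outDegree]
    · intro u w hw; simp [State.empty] at hw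
    · intro u w hw; simp [State.empty] at hw
    · intro u; simp [State.empty, outDegree]
    · intro u v; simp [State.empty]
  | @insert G s s' u v _ huv hG hs ih =>
    obtain ⟨i1, i2, i3⟩ := ih
    -- The time is discarded here, so any bound on the degrees will do.
    obtain ⟨s'', e, ⟨j1, j2, j3⟩, -⟩ := insertEdge_spec hε i1 i2 huv (M := ∑ w, s.deg w + b)
      fun w => Nat.add_le_add_right (Finset.single_le_sum (f := s.deg)
        (fun _ _ => Nat.zero_le _) (Finset.mem_univ w)) b
    obtain rfl := Option.some.inj (hs.symm.trans e)
    refine ⟨j1, j2, fun a c => ?_⟩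
    rw [j3, i3, pairInd]
    simp only [SimpleGraph.sup_adj, SimpleGraph.edge_adj]
    by_cases h1 : (a = u ∧ c = v) ∨ (a = v ∧ c = u)
    · have h2 : ¬ G.Adj a c := by
        rcases h1 with ⟨rfl, rfl⟩ | ⟨rfl, rfl⟩
        · exact hG
        · exact fun h => hG h.symm
      have h3 : a ≠ c := by
        rcases h1 with ⟨rfl, rfl⟩ | ⟨rfl, rfl⟩
        · exact huv
        · exact huv.symm
      simp [h2, h1, h3]
    · simp [h1]
  | @delete G s s' u v _ hG hs ih =>
    obtain ⟨i1, i2, i3⟩ := ih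
    obtain ⟨s'', e, ⟨j1, j2, j3⟩, -⟩ := deleteEdge_spec hε i1 i2 (by rw [i3, if_pos hG])
      (M := ∑ w, s.deg w) fun w => Finset.single_le_sum (f := s.deg)
        (fun _ _ => Nat.zero_le _) (Finset.mem_univ w)
    obtain rfl := Option.some.inj (hs.symm.trans e)
    refine ⟨j1, j2, fun a c => ?_⟩
    have := j3 a c
    rw [i3, pairInd] at this
    simp only [SimpleGraph.deleteEdges_adj, Set.mem_singleton_iff, Sym2.eq_iff]
    by_cases h1 : (a = u ∧ c = v) ∨ (a = v ∧ c = u)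
    · have h2 : G.Adj a c := by
        rcases h1 with ⟨rfl, rfl⟩ | ⟨rfl, rfl⟩
        · exact hG
        · exact hG.symm
      simp only [h1, h2, if_true, not_true, and_false, if_false] at this ⊢
      omega
    · simpa [h1] using this

/-- If only d(u) ≤ d(v) + 1 is known, then d(u) + d(v) ≥ b makes d(v) nearly b/2, so η d(v) / b
exceeds 1. -/
theorem Inv.arc_le_of_orientation {η : ℝ} {b : ℕ} (hη : 1280 < η) (hb : 69 * η ≤ b)
    (hε : Small (η / b)) {G : SimpleGraph (Fin n)} {s : State n} (h : Inv (η / b) s)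
    (he : Exact s) (hG : IsOrientationOfCopies b G s.mult) {u v : Fin n} (huv : 0 < s.mult u v) :
    (s.deg u : ℝ) ≤ (1 + η / b) * s.deg v := by
  have hb0 : (0 : ℝ) < b := by linarith
  rcases le_max_iff.1 (h.arc_le hε huv) with h1 | h1
  · exact h1
  have mult_le : ∀ x y, s.mult x y ≤ s.deg x := fun x y => by
    rw [← he x]
    exact Finset.single_le_sum (f := s.mult x) (fun _ _ => Nat.zero_le _) (Finset.mem_univ y)
  have h2 := hG u v
  rw [if_pos (by by_contra hn; rw [if_neg hn] at h2; omega)] at h2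
  have h3 : (b : ℝ) ≤ s.deg u + s.deg v := by
    have := mult_le u v
    have := mult_le v u
    exact_mod_cast (by omega : b ≤ s.deg u + s.deg v)
  have h4 : 1 ≤ η / b * s.deg v := by
    rw [div_mul_eq_mul_div, le_div_iff₀ hb0]
    nlinarith
  linarith

theorem IsOrientationOfCopies.isOrientation {b : ℕ} (hb : 0 < b) {G : SimpleGraph (Fin n)}
    {m : Fin n → Fin n → ℕ} {A : Fin n → Finset (Fin n)} (h : IsOrientationOfCopies b G m)
    (hA : ∀ u v, v ∈ A u ↔ wins m u v) : IsOrientation G A := by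
  intro u v
  rw [hA, hA]
  unfold wins
  have h1 := h u v
  split_ifs at h1 with hG
  · have hne := hG.ne
    simp only [hG, iff_true]
    constructor
    · rcases lt_trichotomy (m u v) (m v u) with h2 | h2 | h2
      · exact Or.inr (Or.inl h2)
      · rcases lt_or_gt_of_ne hne with h3 | h3
        · exact Or.inl (Or.inr ⟨h2, by omega, h3⟩)
        · exact Or.inr (Or.inr ⟨h2.symm, by omega, h3⟩)
      · exact Or.inl (Or.inl h2)
    · rintro ⟨h2 | ⟨h2, -, h3⟩, h4 | ⟨h4, -, h5⟩⟩
      · omega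
      · omega
      · omega
      · exact absurd h3 h5.asymm
  · simp only [hG, iff_false]
    constructor
    · rintro ((h2 | ⟨h2, h3, -⟩) | (h2 | ⟨h2, h3, -⟩)) <;> omega
    · rintro ⟨h2 | ⟨h2, h3, -⟩, -⟩ <;> omega

/-- The winning direction of an edge carries at least b/2 of its copies. -/
theorem card_mul_le_outDegree {b : ℕ} {G : SimpleGraph (Fin n)}
    {m : Fin n → Fin n → ℕ} {A : Fin n → Finset (Fin n)} (h : IsOrientationOfCopies b G m)
    (hA : ∀ u v, v ∈ A u ↔ wins m u v) (u : Fin n) : (A u).card * b ≤ 2 * outDegree m u := by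
  have h1 : ∑ _v ∈ A u, b ≤ ∑ v ∈ A u, 2 * m u v := by
    refine Finset.sum_le_sum fun v hv => ?_
    have h2 := (hA u v).1 hv
    have h3 := h u v
    unfold wins at h2
    split_ifs at h3 <;> omega
  rw [Finset.sum_const, smul_eq_mul, ← Finset.mul_sum] at h1
  refine h1.trans (Nat.mul_le_mul_left 2 ?_)
  exact Finset.sum_le_sum_of_subset (f := m u) (Finset.subset_univ _)

/-! ### Running time -/

theorem half_le_log_one_add {x : ℝ} (h0 : 0 < x) (h1 : x ≤ 1) : x / 2 ≤ Real.log (1 + x) := by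
  have := Real.one_sub_inv_le_log_of_pos (by linarith : 0 < 1 + x)
  refine le_trans ?_ this
  rw [← one_div, le_sub_iff_add_le, ← le_sub_iff_add_le', div_le_iff₀ (by linarith)]
  nlinarith

/-- The constant must not depend on η. Every factor 1/ε = b/η coming from a logarithm of base near 1
offsets the η that arises inside the logarithm. -/
theorem arcTime_le {η ρ : ℝ} {b M : ℕ} (hη : 1280 < η) (hb : 69 * η ≤ b) (hε : Small (η / b))
    (hρ : 0 ≤ ρ) (hM : (M : ℝ) ≤ b * (4 * ρ + 1)) :
    arcTime (η / b) M ≤ 60 * b ^ 2 * Real.log (2 + ρ) := by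
  obtain ⟨κ, hκ, hκ1, hκ2⟩ := hε.batch
  have hb0 : (88000 : ℝ) < b := by linarith
  have hη0 : 0 < η := by linarith
  have hε0 := hε.1
  have hl2 := Real.log_two_gt_d9
  have hl : 0.69 ≤ Real.log (2 + ρ) :=
    le_trans (by linarith) (Real.log_le_log (by norm_num) (by linarith : (2 : ℝ) ≤ 2 + ρ))
  set l := Real.log (2 + ρ) with hldef
  have hkr : (batch (η / b) : ℝ) = κ + 1 := by rw [hκ]; push_cast; rfl
  -- From κ ≤ 128 b / η and η > 1280.
  have hκb : (κ : ℝ) ≤ b / 10 := by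
    rw [div_mul_eq_mul_div, div_le_iff₀ (by linarith)] at hκ2
    nlinarith
  have hk0 : (0 : ℝ) < κ + 1 := by positivity
  have hdepth : depth (η / b) M ≤ 9 * b + 8 * b * l := by
    unfold depth
    rw [hkr]
    have e1 : η / b / 8 ≤ Real.log (1 + η / b / 4) := by
      have := half_le_log_one_add (x := η / b / 4) (by linarith) (by linarith [hε.2])
      linarith
    have e2 : max (M : ℝ) (κ + 1) / (κ + 1) ≤ η * (2 + ρ) := by
      rw [div_le_iff₀ hk0]
      rw [div_mul_eq_mul_div, le_div_iff₀ (by linarith)] at hκ1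
      refine max_le ?_ ?_
      · refine hM.trans ?_
        have : 127 * (b : ℝ) * (2 + ρ) ≤ η * κ * (2 + ρ) := by gcongr
        nlinarith [mul_nonneg hη0.le hρ]
      · have : 1 ≤ η * (2 + ρ) := by nlinarith
        nlinarith
    -- The crude log η ≤ η suffices: division by log(1 + ε/4) ≥ η / (8b) turns it into 8b.
    have e3 : Real.log (max (M : ℝ) (κ + 1) / (κ + 1)) ≤ η + l := by
      have h1 : 0 < max (M : ℝ) (κ + 1) / (κ + 1) :=
        div_pos (lt_of_lt_of_le hk0 (le_max_right _ _)) hk0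
      refine (Real.log_le_log h1 e2).trans ?_
      rw [Real.log_mul hη0.ne' (by linarith)]
      linarith [Real.log_le_self hη0.le]
    have e4 : Real.log (max (M : ℝ) (κ + 1) / (κ + 1)) / Real.log (1 + η / b / 4) ≤
        8 * b + 8 * b * l := by
      rw [div_le_iff₀ (lt_of_lt_of_le (by positivity) e1)]
      refine e3.trans ?_
      have : (8 * b + 8 * b * l) * (η / b / 8) = η + η * l := by field_simp
      have h2 : (8 * b + 8 * b * l) * (η / b / 8) ≤
          (8 * b + 8 * b * l) * Real.log (1 + η / b / 4) := by gcongr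
      nlinarith
    have := min_le_right (M : ℝ) (κ + 1)
    linarith
  have hlevel : (level (η / b) (2 * M) : ℝ) ≤ b * (8 * b + l) / 10 := by
    have e0 : 0 ≤ (b : ℝ) * (8 * b + l) / 10 := by positivity
    rcases Nat.eq_zero_or_pos M with rfl | hM0
    · rw [mul_zero, level_zero]
      exact_mod_cast e0
    have hM0' : (1 : ℝ) ≤ M := by exact_mod_cast hM0
    have e1 : η / b / 128 ≤ Real.log (1 + η / b / 64) := by
      have := half_le_log_one_add (x := η / b / 64) (by linarith) (by linarith [hε.2])
      linarith
    have e2 : Real.log ((2 * M : ℕ) : ℝ) ≤ 8 * b + l := by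
      push_cast
      have : (2 * M : ℝ) ≤ 8 * b * (2 + ρ) := by nlinarith
      refine (Real.log_le_log (by linarith) this).trans ?_
      rw [Real.log_mul (by linarith) (by linarith)]
      linarith [Real.log_le_self (by linarith : (0 : ℝ) ≤ 8 * b)]
    have e3 : Real.logb (1 + η / b / 64) ((2 * M : ℕ) : ℝ) ≤ b * (8 * b + l) / 10 := by
      unfold Real.logb
      rw [div_le_iff₀ (lt_of_lt_of_le (by positivity) e1)]
      refine e2.trans ?_
      have h1 : b * (8 * b + l) / 10 * (η / b / 128) = (8 * b + l) * (η / 1280) := by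
        field_simp; norm_num
      have h2 : b * (8 * b + l) / 10 * (η / b / 128) ≤
          b * (8 * b + l) / 10 * Real.log (1 + η / b / 64) := by gcongr
      -- The denominator 10 in the bound for the level is 1280/128, so η > 1280 suffices exactly.
      have h3 : 8 * b + l ≤ (8 * b + l) * (η / 1280) :=
        le_mul_of_one_le_right (by positivity) (by rw [le_div_iff₀] <;> linarith)
      linarith
    refine (Nat.floor_le (Real.logb_nonneg (by linarith) ?_)).trans e3
    push_cast
    linarith
  have hA : (220 + 14 * batch (η / b) : ℝ) ≤ 2 * b := by
    rw [hkr]; linarith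
  have hA' : (220 + 14 * batch (η / b) : ℝ) * (depth (η / b) M + 1) ≤ 2 * b * (23 * b * l) := by
    have h1 := depth_nonneg hε M
    have : depth (η / b) M + 1 ≤ 23 * b * l := by nlinarith
    gcongr
  have hbl : 69 / 100 * (b : ℝ) ≤ b * l := by nlinarith
  have hb2 : 2 + (b * (8 * b + l) / 10 : ℝ) ≤ 10 * b ^ 2 * l := by
    have h1 : 69 / 100 * (b : ℝ) ^ 2 ≤ b ^ 2 * l := by nlinarith [sq_nonneg (b : ℝ)]
    have h2 : b * l ≤ (b : ℝ) ^ 2 * l :=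
      mul_le_mul_of_nonneg_right (by nlinarith) (by linarith)
    linarith
  unfold arcTime
  linarith

theorem terminatesWithin_of_steps_le {C ρ : ℝ} {b : ℕ} {s s' : State n} {r : Option (State n)}
    (hC : 0 ≤ C) (hρ : 0 ≤ ρ) (hr : r = some s')
    (h : (s'.steps : ℝ) ≤ s.steps + C * (b : ℝ) ^ 3 * Real.log (2 + ρ)) :
    TerminatesWithin C ρ b s r := by
  refine ⟨s', hr, by linarith, fun K hK => ?_⟩
  have hl : 0 ≤ Real.log (2 + ρ) := Real.log_nonneg (by linarith)
  have : C * (b : ℝ) ^ 3 * Real.log (2 + ρ) ≤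
      C * (K * Real.log n) ^ 3 * Real.log (2 + ρ) := by gcongr
  rw [mul_pow, ← mul_assoc] at this
  linarith

end DynOrient

/-! ### Assembly of the theorem -/

theorem mainTheorem1 (γ : ℝ) (hγ : 0 < γ) :
    ∃ C : ℝ, 0 < C ∧
      (∀ (n b : ℕ) (η : ℝ), DynOrient.Admissible γ η n b →
        ∀ (G : SimpleGraph (Fin n)) (s : DynOrient.State n), DynOrient.Reachable η b G s →
          DynOrient.IsOrientationOfCopies b G s.mult ∧
          (∀ u v, 0 < s.mult u v →
            (DynOrient.outDegree s.mult u : ℝ) ≤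
              (1 + η * (b : ℝ)⁻¹) * (DynOrient.outDegree s.mult v : ℝ)) ∧
          (∀ u, (DynOrient.outDegree s.mult u : ℝ) ≤ C * (b * DynOrient.maxDensity G)) ∧
          DynOrient.IsOrientation G s.out ∧
          (∀ u, ((s.out u).card : ℝ) ≤ C * DynOrient.maxDensity G) ∧
          (∀ u v, u ≠ v → ¬ G.Adj u v →
            DynOrient.TerminatesWithin C (DynOrient.maxDensity G) b s
              (DynOrient.insertEdge η b s u v)) ∧
          (∀ u v, G.Adj u v →
            DynOrient.TerminatesWithin C (DynOrient.maxDensity G) b s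
              (DynOrient.deleteEdge η b s u v))) ∧
      (∀ η : ℝ, 1280 < η → ∃ K : ℝ, ∀ n : ℕ, 2 ≤ n →
        ∃ b : ℕ, DynOrient.Admissible γ η n b ∧ (b : ℝ) ≤ K * Real.log n) := by
  -- The running time determines 60; the out-degree bounds need only 4 and 8.
  refine ⟨60, by norm_num, fun n b η hadm G s hr => ?_, fun η hη =>
    DynOrient.exists_admissible hη⟩
  obtain ⟨hinv, hex, hor⟩ := hr.spec hadm
  have hε := hadm.small
  have hη : 1280 < η := hadm.2.2.1
  have hb := hadm.le_b
  have hb0 : (0 : ℝ) < b := by linarith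
  have hρ := DynOrient.maxDensity_nonneg G
  have hbρ : 0 ≤ b * DynOrient.maxDensity G := by positivity
  have hslope : ∀ u v, 0 < s.mult u v → (DynOrient.outDegree s.mult u : ℝ) ≤
      (1 + η / b) * (DynOrient.outDegree s.mult v : ℝ) := fun u v huv => by
    rw [hex u, hex v]
    exact hinv.arc_le_of_orientation hη hb hε hex hor huv
  have hdeg := DynOrient.outDegree_le_of_slope hε.1.le hadm.pow_le hor hslope
  -- The extra b covers the growth of degrees within one edge insertion, so the density before the
  -- update suffices.
  have hM : ∀ w, s.deg w + b ≤ ⌊4 * (b * DynOrient.maxDensity G)⌋₊ + b := fun w =>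
    Nat.add_le_add_right (Nat.le_floor (by rw [← hex w]; exact hdeg w)) b
  have hMr : ((⌊4 * (b * DynOrient.maxDensity G)⌋₊ + b : ℕ) : ℝ) ≤
      b * (4 * DynOrient.maxDensity G + 1) := by
    have := Nat.floor_le (by positivity : 0 ≤ 4 * (b * DynOrient.maxDensity G))
    push_cast
    linarith
  have htime := mul_le_mul_of_nonneg_left (DynOrient.arcTime_le hη hb hε hρ hMr) hb0.le
  refine ⟨hor, ?_, fun u => (hdeg u).trans (by linarith), hor.isOrientation hadm.2.1 hinv.out_iff,
    fun u => ?_, fun u v huv _ => ?_, fun u v huv => ?_⟩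
  · rw [← div_eq_mul_inv]
    exact hslope
  · have h1 : ((s.out u).card : ℝ) * b ≤ 2 * DynOrient.outDegree s.mult u := by
      exact_mod_cast DynOrient.card_mul_le_outDegree hor hinv.out_iff u
    have h2 := hdeg u
    refine le_of_mul_le_mul_right ?_ hb0
    linarith
  · obtain ⟨s', e, -, ht⟩ := DynOrient.insertEdge_spec hε hinv hex huv hM
    exact DynOrient.terminatesWithin_of_steps_le (by norm_num) hρ e (by linarith)
  · obtain ⟨s', e, -, ht⟩ := DynOrient.deleteEdge_spec hε hinv hex
      (by rw [hor, if_pos huv]) fun w => (Nat.le_add_right _ _).trans (hM w)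
    exact DynOrient.terminatesWithin_of_steps_le (by norm_num) hρ e (by linarith)
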